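/- Let $E$ be a Hausdorff, sequentially complete, barreled locally convex space over $\mathbb{C}$, let $L(E)$ be the space of continuous linear operators on $E$ (with the topology of uniform convergence on bounded sets), and let $C\in L(E)$, not necessarily injective. Let $\mathcal{D}=C_0^\infty(\mathbb{R})$ be the space of complex-valued test functions with its usual topology, and put $g_\beta(t)=t^{\beta-1}/\Gamma(\beta)$ for $\beta>0$, $t>0$; at $t=0$ read $g_1(0)=1$ and $g_\beta(0)=0$ for $\beta>1$. Integrals of $E$-valued functions are understood in the weak sense: $\int_M F(t)\,dt=v$ means that for every continuous linear functional $x^*$ on $E$ the function $\langle x^*,F(\cdot)\rangle$ is integrable on $M$ with integral $\langle x^*,v\rangle$. For $\alpha\ge 0$, a global $\alpha$-times integrated $C$-semigroup is a family $(S_\alpha(t))_{t\ge 0}\subseteq L(E)$ such that $t\mapsto S_\alpha(t)x$ is continuous on $[0,\infty)$ for every $x\in E$, $S_\alpha(t)C=CS_\alpha(t)$ for $t\ge0$, and, for all $t,s\ge 0$ and $x\in E$, $$S_\alpha(t)S_\alpha(s)x=\Bigl[\int_0^{t+s}-\int_0^t-\int_0^s\Bigr]g_\alpha(t+s-r)S_\alpha(r)Cx\,dr\quad\text{if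 }\alpha>0,\qquad S_0(t)S_0(s)x=S_0(t+s)Cx\quad\text{if }\alpha=0.$$ Its integral generator is the multivalued linear operator (linear relation) $$\Bigl\{(x,y)\in E\times E:\ S_\alpha(t)x-g_{\alpha+1}(t)Cx=\int_0^tS_\alpha(s)y\,ds\ \text{ for all }t\ge0\Bigr\}.$$ The Weyl fractional derivative of $\varphi\in\mathcal{D}$ is $W^n_+\varphi=(-1)^n\varphi^{(n)}$ for $n\in\mathbb{N}_0$ and, for $\alpha\in(0,\infty)\setminus\mathbb{N}$ and $n=\lceil\alpha\rceil$, $$W^\alpha_+\varphi(t)=\frac{(-1)^n}{\Gamma(n-\alpha)}\frac{d^n}{dt^n}\int_t^\infty(s-t)^{n-\alpha-1}\varphi(s)\,ds,\qquad t\in\mathbb{R}.$$ A pre-(C-DS) is a continuous linear map $\mathcal{G}:\mathcal{D}\to L(E)$ (an $L(E)$-valued distribution) with support in $[0,\infty)$ such that $C\mathcal{G}(\varphi)=\mathcal{G}(\varphi)C$ and $\mathcal{G}(\varphi*_0\psi)C=\mathcal{G}(\varphi)\mathcal{G}(\psi)$ for all $\varphi,\psi\in\mathcal{D}$, where $(\varphi*_0\psi)(t)=\int_0^t\varphi(t-s)\psi(s)\,ds$,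 $t\in\mathbb{R}$. Its (integral) generator is the multivalued linear operator $$\bigl\{(x,y)\in E\times E:\ \mathcal{G}(-\varphi')x=\mathcal{G}(\varphi)y\ \text{ for all }\varphi\in\mathcal{D}\text{ with }\operatorname{supp}\varphi\subseteq[0,\infty)\bigr\}.$$ **Theorem.** Let $\alpha\ge0$ and let $\mathcal{A}$ be the integral generator of a global $\alpha$-times integrated $C$-semigroup $(S_\alpha(t))_{t\ge0}$ on $E$. Then the integrals $$\mathcal{G}(\varphi)x=\int_0^\infty W^\alpha_+\varphi(t)\,S_\alpha(t)x\,dt,\qquad x\in E,\ \varphi\in\mathcal{D},$$ exist and define a pre-(C-DS) $\mathcal{G}$ whose integral generator contains $\mathcal{A}$. -/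

import Mathlib

open Set Filter Topology MeasureTheory TopologicalSpace
open scoped Distributions ContDiff Convolution

noncomputable section

namespace DegenerateCSemigroup

/-! ### Test functions on the real line -/

/-- The Schwartz space `𝒟 = C₀^∞(ℝ)` of complex-valued test functions on `ℝ`, with its canonical
(inductive limit) topology. -/
abbrev TestFn : Type := TestFunction (⊤ : Opens ℝ) ℂ ⊤

/-- The derivative `φ'` of a test function, as a test function. -/
def testDeriv (φ : TestFn) : TestFn where
  toFun := deriv φ
  contDiff' := (contDiff_infty_iff_deriv.mp φ.contDiff).2
  hasCompactSupport' := φ.hasCompactSupport.deriv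
  tsupport_subset' := fun _ _ => trivial

/-- The finite convolution `(φ *₀ ψ)(t) = ∫₀ᵗ φ(t - s) ψ(s) ds`, `t ∈ ℝ`. -/
def conv0Fun (φ ψ : ℝ → ℂ) (t : ℝ) : ℂ := ∫ s in (0 : ℝ)..t, φ (t - s) * ψ s

theorem conv0Fun_eq (φ ψ : TestFn) :
    conv0Fun φ ψ =
      ((Ioi (0 : ℝ)).indicator ψ) ⋆[ContinuousLinearMap.mul ℝ ℂ, volume] (φ : ℝ → ℂ) -
      ((Iio (0 : ℝ)).indicator φ) ⋆[ContinuousLinearMap.mul ℝ ℂ, volume] (ψ : ℝ → ℂ) := by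
  funext t
  have hint : Integrable (fun s => φ (t - s) * ψ s) := by
    refine Continuous.integrable_of_hasCompactSupport (by fun_prop) ?_
    exact ψ.hasCompactSupport.mul_left
  have h1 : (((Ioi (0 : ℝ)).indicator ψ) ⋆[ContinuousLinearMap.mul ℝ ℂ, volume] (φ : ℝ → ℂ)) t
      = ∫ s in Ioi (0 : ℝ), φ (t - s) * ψ s := by
    rw [convolution_def, ← integral_indicator measurableSet_Ioi]
    congr 1
    funext s
    by_cases hs : s ∈ Ioi (0 : ℝ) <;> simp [hs, indicator, mul_comm]
  have h2 : (((Iio (0 : ℝ)).indicator φ) ⋆[ContinuousLinearMap.mul ℝ ℂ, volume] (ψ : ℝ → ℂ)) t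
      = ∫ s in Ioi t, φ (t - s) * ψ s := by
    rw [convolution_def, ← integral_indicator measurableSet_Ioi,
      ← integral_sub_left_eq_self _ volume t]
    congr 1
    funext s
    by_cases hs : t < s <;> simp [hs, indicator]
  rw [Pi.sub_apply, h1, h2, conv0Fun,
    intervalIntegral.integral_Ioi_sub_Ioi' hint.integrableOn hint.integrableOn]

/-- `φ *₀ ψ` as a test function. -/
def conv0 (φ ψ : TestFn) : TestFn where
  toFun := conv0Fun φ ψ
  contDiff' := by
    rw [conv0Fun_eq]
    refine ContDiff.sub ?_ ?_
    · exact φ.hasCompactSupport.contDiff_convolution_right _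
        (((ψ.continuous.integrable_of_hasCompactSupport
          ψ.hasCompactSupport).indicator measurableSet_Ioi).locallyIntegrable) φ.contDiff
    · exact ψ.hasCompactSupport.contDiff_convolution_right _
        (((φ.continuous.integrable_of_hasCompactSupport
          φ.hasCompactSupport).indicator measurableSet_Iio).locallyIntegrable) ψ.contDiff
  hasCompactSupport' := by
    have hind : ∀ (s : Set ℝ) (f : TestFn), HasCompactSupport (s.indicator f) := fun s f =>
      f.hasCompactSupport.mono (by
        intro x hx
        have := indicator_apply_ne_zero.mp hx
        exact this.2)
    rw [conv0Fun_eq]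
    exact (HasCompactSupport.convolution _ (hind _ ψ) φ.hasCompactSupport).sub
      (HasCompactSupport.convolution _ (hind _ φ) ψ.hasCompactSupport)
  tsupport_subset' := fun _ _ => trivial

theorem conv0_apply (φ ψ : TestFn) (t : ℝ) :
    conv0 φ ψ t = ∫ s in (0 : ℝ)..t, φ (t - s) * ψ s := rfl

/-- The Weyl fractional derivative `W^α_+ f` of order `α ≥ 0`. With `n = ⌈α⌉`, it is
`(-1)ⁿ f⁽ⁿ⁾` if `α = n`, and
`(-1)ⁿ / Γ(n - α) · dⁿ/dtⁿ ∫_t^∞ (s - t)^(n - α - 1) f(s) ds` if `α` is not an integer. -/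
def weylDeriv (α : ℝ) (f : ℝ → ℂ) (t : ℝ) : ℂ :=
  if α = (⌈α⌉₊ : ℝ) then (-1) ^ ⌈α⌉₊ * iteratedDeriv ⌈α⌉₊ f t
  else (-1) ^ ⌈α⌉₊ / (Real.Gamma (⌈α⌉₊ - α) : ℂ) *
    iteratedDeriv ⌈α⌉₊
      (fun r => ∫ s in Ioi r, (((s - r) ^ ((⌈α⌉₊ : ℝ) - α - 1) : ℝ) : ℂ) * f s) t

/-- `g_α(t) = t^(α - 1) / Γ(α)` -/
def gFun (α t : ℝ) : ℝ := t ^ (α - 1) / Real.Gamma α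

/-! ### Vector-valued integrals, integrated semigroups, distribution semigroups -/

variable {E : Type*} [AddCommGroup E] [Module ℂ E] [TopologicalSpace E]

/-- `v = ∫_s F(t) dt` for an `E`-valued function `F`: every continuous linear functional `f` on `E`
makes `f ∘ F` Lebesgue integrable on `s`, with integral `f v`. In a Hausdorff locally convex
space there is at most one such `v`. -/
def HasVectorIntegral (F : ℝ → E) (s : Set ℝ) (v : E) : Prop :=
  ∀ f : E →L[ℂ] ℂ, IntegrableOn (fun t => f (F t)) s ∧ ∫ t in s, f (F t) = f v

theorem HasVectorIntegral.add {F G : ℝ → E} {s : Set ℝ} {v w : E}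
    (hF : HasVectorIntegral F s v) (hG : HasVectorIntegral G s w) :
    HasVectorIntegral (fun t => F t + G t) s (v + w) := fun f => by
  simp only [map_add]
  exact ⟨(hF f).1.add (hG f).1, by
    rw [integral_add (hF f).1 (hG f).1, (hF f).2, (hG f).2]⟩

theorem HasVectorIntegral.smul {F : ℝ → E} {s : Set ℝ} {v : E} (c : ℂ)
    (hF : HasVectorIntegral F s v) : HasVectorIntegral (fun t => c • F t) s (c • v) := fun f => by
  simp only [map_smul]
  exact ⟨(hF f).1.smul c, by rw [integral_smul, (hF f).2]⟩

/-- `(S(t))_{t ≥ 0} ⊆ L(E)` is a global `α`-times integrated `C`-semigroup (`α ≥ 0`); for `α = 0`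
this means a `C`-regularized semigroup. Only the values `S t` with `t ≥ 0` matter. -/
structure IsIntegratedCSemigroup (α : ℝ) (C : E →L[ℂ] E) (S : ℝ → E →L[ℂ] E) : Prop where
  /-- strong continuity -/
  continuousOn : ∀ x : E, ContinuousOn (fun t => S t x) (Ici 0)
  /-- `S(t) C = C S(t)` -/
  comm : ∀ t : ℝ, 0 ≤ t → ∀ x : E, S t (C x) = C (S t x)
  /-- for `α = 0`: `S(t + s) C = S(t) S(s)` -/
  mul_zero : α = 0 → ∀ t s : ℝ, 0 ≤ t → 0 ≤ s → ∀ x : E, S (t + s) (C x) = S t (S s x)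
  /-- for `α > 0`:
  `S(t) S(s) x = [∫_0^{t+s} - ∫_0^t - ∫_0^s] g_α(t + s - r) S(r) C x dr` -/
  mul_pos : 0 < α → ∀ t s : ℝ, 0 ≤ t → 0 ≤ s → ∀ x : E, ∃ I₁ I₂ I₃ : E,
    HasVectorIntegral (fun r => (gFun α (t + s - r) : ℂ) • S r (C x)) (Ioc 0 (t + s)) I₁ ∧
    HasVectorIntegral (fun r => (gFun α (t + s - r) : ℂ) • S r (C x)) (Ioc 0 t) I₂ ∧
    HasVectorIntegral (fun r => (gFun α (t + s - r) : ℂ) • S r (C x)) (Ioc 0 s) I₃ ∧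
    S t (S s x) = I₁ - I₂ - I₃

section

variable [IsTopologicalAddGroup E] [ContinuousSMul ℂ E]

/-- The integral generator of a global `α`-times integrated `C`-semigroup, a multivalued linear
operator in `E` identified with its graph: the pairs `(x, y)` such that
`S(t) x - g_{α+1}(t) C x = ∫_0^t S(s) y ds` for all `t ≥ 0`. -/
def integralGenerator (α : ℝ) (C : E →L[ℂ] E) (S : ℝ → E →L[ℂ] E) : Submodule ℂ (E × E) where
  carrier := {p | ∀ t : ℝ, 0 ≤ t →
    HasVectorIntegral (fun s => S s p.2) (Ioc 0 t) (S t p.1 - (gFun (α + 1) t : ℂ) • C p.1)}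
  add_mem' := by
    intro p q hp hq t ht
    have h := (hp t ht).add (hq t ht)
    have e : S t (p + q).1 - (gFun (α + 1) t : ℂ) • C (p + q).1 =
        (S t p.1 - (gFun (α + 1) t : ℂ) • C p.1) + (S t q.1 - (gFun (α + 1) t : ℂ) • C q.1) := by
      simp only [Prod.fst_add, map_add, smul_add]
      abel
    rw [e]
    simpa only [Prod.snd_add, map_add] using h
  zero_mem' := by
    intro t ht f
    simp
  smul_mem' := by
    intro c p hp t ht
    have h := (hp t ht).smul c
    have e : S t (c • p).1 - (gFun (α + 1) t : ℂ) • C (c • p).1 =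
        c • (S t p.1 - (gFun (α + 1) t : ℂ) • C p.1) := by
      simp only [Prod.smul_fst, map_smul, smul_sub, smul_comm c]
    rw [e]
    simpa only [Prod.smul_snd, map_smul] using h

/-- `G ∈ 𝒟'(L(E)) = L(𝒟, L(E))` is a pre-(C-DS). Here `L(E)` carries the topology of uniform
convergence on bounded sets. -/
structure IsPreCDS (C : E →L[ℂ] E) (G : TestFn →L[ℂ] (E →L[ℂ] E)) : Prop where
  /-- the support of `G` is contained in `[0, ∞)` -/
  support : ∀ φ : TestFn, tsupport φ ⊆ Iio 0 → G φ = 0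
  /-- `C G = G C` -/
  comm : ∀ φ : TestFn, C ∘L G φ = G φ ∘L C
  /-- `G(φ *₀ ψ) C = G(φ) G(ψ)` -/
  mul : ∀ φ ψ : TestFn, G (conv0 φ ψ) ∘L C = G φ ∘L G ψ

/-- The (integral, infinitesimal) generator `G(-δ')` of `G`: the pairs `(x, y)` such that
`G((-δ') * φ) x = G(φ) y` for all test functions `φ` supported in `[0, ∞)`, where
`(-δ') * φ = -φ'`. -/
def distGenerator (G : TestFn →L[ℂ] (E →L[ℂ] E)) : Submodule ℂ (E × E) where
  carrier := {p | ∀ φ : TestFn, tsupport φ ⊆ Ici 0 → G (-testDeriv φ) p.1 = G φ p.2}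
  add_mem' := by
    intro p q hp hq φ hφ
    simp only [Prod.fst_add, Prod.snd_add, map_add, hp φ hφ, hq φ hφ]
  zero_mem' := by
    intro φ _
    simp
  smul_mem' := by
    intro c p hp φ hφ
    simp only [Prod.smul_fst, Prod.smul_snd, map_smul, hp φ hφ]

end

end DegenerateCSemigroup

end

/-!
Put `F(t) = S_α(t)x`. The Weyl derivative `W^α φ` is the right fractional integral, of order
`⌈α⌉ - α`, of `(-1)^⌈α⌉ φ^(⌈α⌉)`; by the Beta integral fractional integrals form a semigroup, so the
fractional integral of order `α` inverts `W^α`.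

For multiplicativity, the composition law of `S_α` writes `𝒢(φ)𝒢(ψ)x` as the integral of
`W^α φ(t) W^α ψ(s) [∫_0^{t+s} - ∫_0^t - ∫_0^s] g_α(t+s-r) CF(r) dr` over `t, s > 0`. Collecting the
coefficient of `CF(r)` gives a scalar kernel. Its fractional integral of order `α` can be computed
with the reflection `r ↦ t + s + τ - r`, which interchanges the two copies of `g_α`: it is `φ *₀ ψ`,
which is also the fractional integral of `W^α(φ *₀ ψ)`. Fractional integration is injective up to
null sets, so the kernel is `W^α(φ *₀ ψ)`.

The inclusion of generators is an integration by parts, in which the term `g_{α+1}(t) Cx` drops out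
because `∫ W^α(φ') g_{α+1} = -φ(0) = 0`. The weak integrals exist because their Riemann sums are
Cauchy sequences; the bounds that make `𝒢` continuous come from the Banach-Steinhaus theorem on the
barrelled space `E`.
-/

noncomputable section

namespace DegenerateCSemigroup

section FractionalKernel

/-- The kernel `g_β` of fractional integration, extended by zero to the whole real line. -/
def fracKer (β : ℝ) : ℝ → ℝ := (Ioi 0).indicator (gFun β)

variable {β γ : ℝ}

theorem fracKer_of_pos {y : ℝ} (hy : 0 < y) : fracKer β y = gFun β y :=
  indicator_of_mem (mem_Ioi.2 hy) _

theorem fracKer_of_nonpos {y : ℝ} (hy : y ≤ 0) : fracKer β y = 0 :=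
  indicator_of_notMem (notMem_Ioi.2 hy) _

@[fun_prop]
theorem measurable_fracKer (β : ℝ) : Measurable (fracKer β) :=
  Measurable.indicator (by unfold gFun; fun_prop) measurableSet_Ioi

theorem fracKer_nonneg (hβ : 0 ≤ β) (y : ℝ) : 0 ≤ fracKer β y :=
  indicator_nonneg (fun _ hy => div_nonneg (Real.rpow_nonneg (le_of_lt hy) _)
    (Real.Gamma_nonneg_of_nonneg hβ)) y

theorem fracKer_one : fracKer 1 = (Ioi 0).indicator 1 :=
  congrArg (indicator _) (funext fun y => by simp [gFun])

theorem integrableOn_fracKer_Iic (hβ : 0 < β) (T : ℝ) : IntegrableOn (fracKer β) (Iic T) := by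
  rw [fracKer, integrableOn_indicator_iff measurableSet_Ioi, Ioi_inter_Iic]
  have h := (intervalIntegral.intervalIntegrable_rpow' (a := 0) (b := T)
    (show -1 < β - 1 by linarith)).div_const (Real.Gamma β)
  exact h.1

theorem integrableOn_fracKer_sub (hβ : 0 < β) (t R : ℝ) :
    IntegrableOn (fun s => fracKer β (s - t)) (Icc t R) := by
  have h := ((integrableOn_fracKer_Iic hβ (R - t)).integrable_indicator
    measurableSet_Iic).comp_sub_right t
  refine h.integrableOn.congr_fun (fun s hs => ?_) measurableSet_Icc
  exact indicator_of_mem (mem_Iic.2 (sub_le_sub_right hs.2 t)) _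

theorem gFun_convolution {x : ℝ} (hβ : 0 < β) (hγ : 0 < γ) (hx : 0 < x) :
    ∫ y in (0 : ℝ)..x, gFun β y * gFun γ (x - y) = gFun (β + γ) x := by
  have hscale := Complex.betaIntegral_scaled β γ hx
  rw [Complex.betaIntegral_eq_Gamma_mul_div _ _ (by simpa) (by simpa)] at hscale
  have hcast : ∫ y in (0 : ℝ)..x, (y : ℂ) ^ ((β : ℂ) - 1) * ((x : ℂ) - y) ^ ((γ : ℂ) - 1) =
      ((∫ y in (0 : ℝ)..x, y ^ (β - 1) * (x - y) ^ (γ - 1) : ℝ) : ℂ) := by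
    rw [← intervalIntegral.integral_ofReal]
    refine intervalIntegral.integral_congr fun y hy => ?_
    rw [uIcc_of_le hx.le] at hy
    push_cast [Complex.ofReal_cpow hy.1, Complex.ofReal_cpow (sub_nonneg.2 hy.2)]
    rfl
  have hreal : ∫ y in (0 : ℝ)..x, y ^ (β - 1) * (x - y) ^ (γ - 1) =
      x ^ (β + γ - 1) * (Real.Gamma β * Real.Gamma γ / Real.Gamma (β + γ)) := by
    have hcpow := Complex.ofReal_cpow hx.le (β + γ - 1)
    push_cast at hcpow
    rw [hcast, ← hcpow, ← Complex.ofReal_add] at hscale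
    simp only [Complex.Gamma_ofReal] at hscale
    exact_mod_cast hscale
  have hΓβ := (Real.Gamma_pos_of_pos hβ).ne'
  have hΓγ := (Real.Gamma_pos_of_pos hγ).ne'
  simp only [gFun, div_mul_div_comm]
  rw [intervalIntegral.integral_div, hreal]
  field_simp

theorem fracKer_convolution (hβ : 0 < β) (hγ : 0 < γ) (t r : ℝ) :
    ∫ s, fracKer β (s - t) * fracKer γ (r - s) = fracKer (β + γ) (r - t) := by
  rw [← integral_add_right_eq_self _ t]
  simp only [add_sub_cancel_right, sub_add_eq_sub_sub_swap]
  generalize r - t = x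
  have hsupp : (fun y => fracKer β y * fracKer γ (x - y)) =
      (Ioo 0 x).indicator fun y => gFun β y * gFun γ (x - y) := by
    funext y
    by_cases h₀ : 0 < y <;> by_cases hx : y < x <;> simp [fracKer, h₀, hx]
  rw [hsupp, integral_indicator measurableSet_Ioo]
  rcases le_or_gt x 0 with hx | hx
  · simp [fracKer_of_nonpos hx, Ioo_eq_empty hx.not_gt]
  · rw [fracKer_of_pos hx, ← gFun_convolution hβ hγ hx, intervalIntegral.integral_of_le hx.le,
      integral_Ioc_eq_integral_Ioo]

theorem integrable_fracKer_mul_fracKer (hβ : 0 < β) (hγ : 0 < γ) (t r : ℝ) :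
    Integrable fun s => fracKer β (s - t) * fracKer γ (r - s) := by
  rcases le_or_gt r t with h | h
  · refine (integrable_zero ℝ ℝ volume).congr (Eventually.of_forall fun s => ?_)
    rcases le_or_gt s t with hs | hs
    · simp [fracKer_of_nonpos (sub_nonpos.2 hs)]
    · simp [fracKer_of_nonpos (sub_nonpos.2 (h.trans hs.le))]
  · refine not_imp_comm.1 integral_undef ?_
    rw [fracKer_convolution hβ hγ, fracKer_of_pos (sub_pos.2 h)]
    exact (div_pos (Real.rpow_pos_of_pos (sub_pos.2 h) _)
      (Real.Gamma_pos_of_pos (add_pos hβ hγ))).ne'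

end FractionalKernel

section FractionalIntegral

/-- The right-sided (Weyl) fractional integral `∫_t^∞ g_β(s - t) h(s) ds` of order `β ≥ 0`; for
`β = 0`, where the kernel degenerates to the Dirac measure, it is `h` itself. -/
def fracInt (β : ℝ) (h : ℝ → ℂ) (t : ℝ) : ℂ :=
  if β = 0 then h t else ∫ s, (fracKer β (s - t) : ℂ) * h s

/-- Absolute convergence of the fractional integral of `h` of order `β` at `t`. It always holds for
`β = 0`, since `Γ(0) = 0` makes `g_0` vanish. -/
def FracIntegrable (β : ℝ) (h : ℝ → ℂ) (t : ℝ) : Prop :=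
  Integrable fun s => (fracKer β (s - t) : ℂ) * h s

variable {β γ : ℝ} {h k : ℝ → ℂ} {t : ℝ}

theorem fracInt_zero (h : ℝ → ℂ) : fracInt 0 h = h := by
  funext t; simp [fracInt]

theorem fracInt_of_pos (hβ : 0 < β) (h : ℝ → ℂ) (t : ℝ) :
    fracInt β h t = ∫ s, (fracKer β (s - t) : ℂ) * h s := by
  simp [fracInt, hβ.ne']

theorem fracInt_one (h : ℝ → ℂ) (t : ℝ) : fracInt 1 h t = ∫ s in Ioi t, h s := by
  rw [fracInt_of_pos one_pos, ← integral_indicator measurableSet_Ioi, fracKer_one]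
  congr with s
  by_cases hs : t < s <;> simp [hs]

theorem fracInt_const_mul (β : ℝ) (c : ℂ) (h : ℝ → ℂ) (t : ℝ) :
    fracInt β (fun s => c * h s) t = c * fracInt β h t := by
  simp only [fracInt, mul_left_comm _ c, integral_const_mul, mul_ite]

theorem fracInt_congr_Ioi (hβ : 0 < β) (hhk : EqOn h k (Ioi t)) :
    fracInt β h t = fracInt β k t := by
  rw [fracInt_of_pos hβ, fracInt_of_pos hβ]
  congr with s
  rcases le_or_gt s t with hs | hs
  · simp [fracKer_of_nonpos (sub_nonpos.2 hs)]
  · rw [hhk hs]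

theorem fracInt_eq_zero (hh : ∀ s ≥ t, h s = 0) : fracInt β h t = 0 := by
  have hker : (fun s => (fracKer β (s - t) : ℂ) * h s) = 0 := by
    funext s
    rcases le_or_gt s t with hs | hs
    · simp [fracKer_of_nonpos (sub_nonpos.2 hs)]
    · simp [hh s hs.le]
  simp [fracInt, hker, hh t le_rfl]

theorem fracInt_eventuallyEq_zero (hh : h =ᶠ[atTop] 0) : fracInt β h =ᶠ[atTop] 0 := by
  obtain ⟨R, hR⟩ := eventually_atTop.1 hh
  filter_upwards [eventually_ge_atTop R] with t ht
  exact fracInt_eq_zero fun s hs => hR s (ht.trans hs)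

theorem fracInt_add (hβ : 0 ≤ β) (hh : FracIntegrable β h t) (hk : FracIntegrable β k t) :
    fracInt β (h + k) t = fracInt β h t + fracInt β k t := by
  rcases hβ.eq_or_lt with rfl | hβ
  · simp [fracInt_zero]
  · simp only [fracInt_of_pos hβ, Pi.add_apply, mul_add]
    exact integral_add hh hk

theorem fracIntegrable_zero : FracIntegrable 0 h t := by
  have hker : fracKer 0 = 0 := indicator_eq_zero'.2 <| by
    rw [show gFun 0 = 0 from funext fun _ => by simp [gFun], Function.support_zero]
    exact empty_disjoint _
  simp [FracIntegrable, hker]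

theorem fracIntegrable_of_continuous (hβ : 0 ≤ β) (hc : Continuous h) (hh : h =ᶠ[atTop] 0) :
    FracIntegrable β h t := by
  rcases hβ.eq_or_lt with rfl | hβ
  · exact fracIntegrable_zero
  obtain ⟨R, hR⟩ := eventually_atTop.1 hh
  have hker : IntegrableOn (fun s => (fracKer β (s - t) : ℂ) * h s) (Icc t R) :=
    IntegrableOn.mul_continuousOn (integrableOn_fracKer_sub hβ t R).ofReal hc.continuousOn
      isCompact_Icc
  refine hker.integrable_of_forall_notMem_eq_zero fun s hs => ?_
  rcases le_or_gt s t with hst | hst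
  · simp [fracKer_of_nonpos (sub_nonpos.2 hst)]
  · simp [hR s (not_le.1 fun hsR => hs ⟨hst.le, hsR⟩).le]

theorem fracIntegrable_of_locallyIntegrable (hβ : 1 ≤ β) (hi : LocallyIntegrable h)
    (hh : h =ᶠ[atTop] 0) : FracIntegrable β h t := by
  obtain ⟨R, hR⟩ := eventually_atTop.1 hh
  have hcont : Continuous fun s : ℝ => (gFun β (s - t) : ℂ) := by
    have : Continuous (gFun β) := (Real.continuous_rpow_const (by linarith)).div_const _
    fun_prop
  have hker : IntegrableOn (fun s => (gFun β (s - t) : ℂ) * h s) (Ioc t R) :=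
    ((hi.integrableOn_isCompact isCompact_Icc).continuousOn_mul hcont.continuousOn
      isCompact_Icc).mono_set Ioc_subset_Icc_self
  refine (hker.integrable_indicator measurableSet_Ioc).congr (Eventually.of_forall fun s => ?_)
  by_cases hst : t < s
  · by_cases hsR : s ≤ R
    · simp [hst, hsR, fracKer]
    · simp [hR s (not_le.1 hsR).le, indicator]
  · simp [hst, fracKer]

theorem fracInt_fracInt (hβ : 0 ≤ β) (hγ : 0 ≤ γ) (hm : AEStronglyMeasurable h)
    (hh : FracIntegrable (β + γ) h t) : fracInt β (fracInt γ h) t = fracInt (β + γ) h t := by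
  rcases hβ.eq_or_lt with rfl | hβ
  · rw [fracInt_zero, zero_add]
  rcases hγ.eq_or_lt with rfl | hγ
  · rw [fracInt_zero, add_zero]
  have hint : Integrable (Function.uncurry fun s r =>
      ((fracKer β (s - t) * fracKer γ (r - s) : ℝ) : ℂ) * h r) (volume.prod volume) := by
    refine (integrable_prod_iff' ?_).2 ⟨Eventually.of_forall fun r =>
      (integrable_fracKer_mul_fracKer hβ hγ t r).ofReal.mul_const (h r), ?_⟩
    · exact (Measurable.aestronglyMeasurable (by fun_prop)).mul hm.comp_snd
    · refine hh.norm.congr (Eventually.of_forall fun r => ?_)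
      have hnn : ∀ s, 0 ≤ fracKer β (s - t) * fracKer γ (r - s) := fun s =>
        mul_nonneg (fracKer_nonneg hβ.le _) (fracKer_nonneg hγ.le _)
      simp only [Function.uncurry, norm_mul _ (h r), Complex.norm_real,
        Real.norm_of_nonneg (hnn _), Real.norm_of_nonneg (fracKer_nonneg (add_pos hβ hγ).le _),
        integral_mul_const, fracKer_convolution hβ hγ]
  rw [fracInt_of_pos hβ, fracInt_of_pos (add_pos hβ hγ)]
  calc ∫ s, (fracKer β (s - t) : ℂ) * fracInt γ h s
      = ∫ s, ∫ r, ((fracKer β (s - t) * fracKer γ (r - s) : ℝ) : ℂ) * h r := by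
        simp only [fracInt_of_pos hγ, ← integral_const_mul, Complex.ofReal_mul, mul_assoc]
    _ = ∫ r, ∫ s, ((fracKer β (s - t) * fracKer γ (r - s) : ℝ) : ℂ) * h r :=
        integral_integral_swap hint
    _ = ∫ r, (fracKer (β + γ) (r - t) : ℂ) * h r := by
        simp only [integral_mul_const, integral_complex_ofReal, fracKer_convolution hβ hγ]

theorem exists_fracInt_one_eq_intervalIntegral (hi : LocallyIntegrable h) (hh : h =ᶠ[atTop] 0) :
    ∃ R, fracInt 1 h = fun t => -∫ s in R..t, h s := by
  obtain ⟨R, hR⟩ := eventually_atTop.1 hh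
  have htail : ∀ a, IntegrableOn h (Ioi a) := fun a => by
    refine ((hi.integrableOn_isCompact (isCompact_Icc (a := a) (b := R))).integrable_indicator
      measurableSet_Icc).integrableOn.congr_fun (fun s hs => ?_) measurableSet_Ioi
    by_cases hsR : s ≤ R
    · simp [(mem_Ioi.1 hs).le, hsR]
    · simp [hR s (not_le.1 hsR).le, indicator]
  have hzero : ∫ s in Ioi R, h s = 0 :=
    setIntegral_eq_zero_of_forall_eq_zero fun s hs => hR s (le_of_lt hs)
  refine ⟨R, funext fun t => ?_⟩
  rw [fracInt_one, ← intervalIntegral.integral_Ioi_sub_Ioi' (htail R) (htail t), hzero]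
  ring

theorem continuous_fracInt_one (hi : LocallyIntegrable h) (hh : h =ᶠ[atTop] 0) :
    Continuous (fracInt 1 h) := by
  obtain ⟨R, hprim⟩ := exists_fracInt_one_eq_intervalIntegral hi hh
  rw [hprim]
  refine (intervalIntegral.continuous_primitive (fun a b => ?_) R).neg
  exact (hi.integrableOn_isCompact isCompact_uIcc).intervalIntegrable

theorem ae_eq_zero_of_fracInt_one_eq_zero (hi : LocallyIntegrable h) (hh : h =ᶠ[atTop] 0)
    (h0 : ∀ t > 0, fracInt 1 h t = 0) : ∀ᵐ t, 0 < t → h t = 0 := by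
  obtain ⟨R, hprim⟩ := exists_fracInt_one_eq_intervalIntegral hi hh
  filter_upwards [LocallyIntegrable.ae_hasDerivAt_integral hi] with t ht ht0
  have hzero : fracInt 1 h =ᶠ[𝓝 t] fun _ => 0 := by
    filter_upwards [lt_mem_nhds ht0] with s hs using h0 s hs
  have hderiv : HasDerivAt (fracInt 1 h) (-h t) t := hprim ▸ (ht R).neg
  exact neg_eq_zero.1 (hderiv.unique ((hasDerivAt_const t 0).congr_of_eventuallyEq hzero))

theorem ae_eq_zero_of_fracInt_nat_eq_zero (n : ℕ) (hi : LocallyIntegrable h)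
    (hh : h =ᶠ[atTop] 0) (h0 : ∀ t > 0, fracInt n h t = 0) : ∀ᵐ t, 0 < t → h t = 0 := by
  induction n generalizing h with
  | zero => exact Eventually.of_forall fun t ht => by simpa [fracInt_zero] using h0 t ht
  | succ n ih =>
    have hcont := continuous_fracInt_one hi hh
    have hae : ∀ᵐ t, 0 < t → fracInt 1 h t = 0 := by
      refine ih hcont.locallyIntegrable (fracInt_eventuallyEq_zero hh) fun t ht => ?_
      rw [fracInt_fracInt n.cast_nonneg zero_le_one hi.aestronglyMeasurable
        (fracIntegrable_of_locallyIntegrable (by simp) hi hh), ← h0 t ht, Nat.cast_succ]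
    refine ae_eq_zero_of_fracInt_one_eq_zero hi hh ?_
    exact Measure.eqOn_open_of_ae_eq ((ae_restrict_iff' measurableSet_Ioi).2 hae) isOpen_Ioi
      hcont.continuousOn continuousOn_const

theorem ceil_sub_nonneg (α : ℝ) : 0 ≤ (⌈α⌉₊ : ℝ) - α := sub_nonneg.2 (Nat.le_ceil α)

theorem ae_eq_zero_of_fracInt_eq_zero (hβ : 0 < β) (hi : LocallyIntegrable h)
    (hh : h =ᶠ[atTop] 0) (h0 : ∀ t > 0, fracInt β h t = 0) : ∀ᵐ t, 0 < t → h t = 0 := by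
  refine ae_eq_zero_of_fracInt_nat_eq_zero ⌈β⌉₊ hi hh fun t ht => ?_
  have hint : FracIntegrable ((⌈β⌉₊ - β) + β) h t := by
    rw [sub_add_cancel]
    exact fracIntegrable_of_locallyIntegrable (by exact_mod_cast Nat.ceil_pos.2 hβ) hi hh
  rw [← sub_add_cancel (⌈β⌉₊ : ℝ) β,
    ← fracInt_fracInt (ceil_sub_nonneg β) hβ.le hi.aestronglyMeasurable hint]
  exact fracInt_eq_zero fun s hs => h0 s (ht.trans_le hs)

theorem ae_eq_of_fracInt_eq (hβ : 0 < β) (hi : LocallyIntegrable h) (hh : h =ᶠ[atTop] 0)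
    (hβh : ∀ t > 0, FracIntegrable β h t) (hc : Continuous k) (hk : k =ᶠ[atTop] 0)
    (heq : ∀ t > 0, fracInt β h t = fracInt β k t) : ∀ᵐ t, 0 < t → h t = k t := by
  have hneg : Continuous fun s => -1 * k s := by fun_prop
  have hneg₀ : (fun s => -1 * k s) =ᶠ[atTop] 0 := by
    filter_upwards [hk] with s hs
    simp [hs]
  have hsum₀ : h + (fun s => -1 * k s) =ᶠ[atTop] 0 := by simpa using hh.add hneg₀
  filter_upwards [ae_eq_zero_of_fracInt_eq_zero hβ (hi.add hneg.locallyIntegrable) hsum₀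
    fun t ht => by
      rw [fracInt_add hβ.le (hβh t ht) (fracIntegrable_of_continuous hβ.le hneg hneg₀),
        fracInt_const_mul, heq t ht, neg_one_mul, add_neg_cancel]] with t ht ht₀
  have hsum : h t + -1 * k t = 0 := ht ht₀
  linear_combination hsum

theorem exists_norm_fracInt_le (hβ : 0 ≤ β) (R : ℝ) : ∃ c : ℝ,
    ∀ (h : ℝ → ℂ) (M : ℝ), (∀ s, ‖h s‖ ≤ M) → (∀ s ≥ R, h s = 0) →
      ∀ t ≥ 0, ‖fracInt β h t‖ ≤ c * M := by
  rcases hβ.eq_or_lt with rfl | hβ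
  · exact ⟨1, fun h M hM _ t _ => by simpa [fracInt_zero] using hM t⟩
  set N := (Iic R).indicator fun y => ‖fracKer β y‖ with hN
  have hNi : Integrable N :=
    IntegrableOn.integrable_indicator (integrableOn_fracKer_Iic hβ R).norm measurableSet_Iic
  refine ⟨∫ y, N y, fun h M hM hR t ht => ?_⟩
  rw [fracInt_of_pos hβ, ← integral_sub_right_eq_self N t, ← integral_mul_const]
  refine norm_integral_le_of_norm_le ((hNi.comp_sub_right t).mul_const M)
    (Eventually.of_forall fun s => ?_)
  have hM0 : 0 ≤ M := (norm_nonneg _).trans (hM s)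
  rcases le_or_gt s R with hs | hs
  · rw [norm_mul, Complex.norm_real, hN, indicator_of_mem (mem_Iic.2 (by linarith))]
    gcongr
    exact hM s
  · rw [hR s hs.le, mul_zero, norm_zero]
    exact mul_nonneg (indicator_nonneg (fun _ _ => norm_nonneg _) _) hM0

end FractionalIntegral

section WeylDerivative

theorem TestFn.eventuallyEq_zero (φ : TestFn) : φ =ᶠ[atTop] (0 : ℝ → ℂ) := by
  have h := φ.hasCompactSupport.isCompact.compl_mem_cocompact
  filter_upwards [atTop_le_cocompact h] with t ht using image_eq_zero_of_notMem_tsupport ht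

theorem iteratedDeriv_eq_iterate_testDeriv (φ : TestFn) (n : ℕ) :
    iteratedDeriv n φ = testDeriv^[n] φ := by
  rw [iteratedDeriv_eq_iterate]
  exact ((Function.Semiconj.iterate_right (f := fun φ : TestFn => ⇑φ) (fun _ => rfl) n) φ).symm

variable {α β γ : ℝ}

theorem fracInt_eq_convolution (hβ : 0 < β) (h : ℝ → ℂ) :
    fracInt β h = (fun s => (fracKer β (-s) : ℂ)) ⋆[ContinuousLinearMap.mul ℝ ℂ, volume] h := by
  funext t
  rw [fracInt_of_pos hβ, convolution_def, ← integral_sub_left_eq_self _ volume t]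
  simp

theorem hasDerivAt_fracInt (hβ : 0 ≤ β) (φ : TestFn) (t : ℝ) :
    HasDerivAt (fracInt β φ) (fracInt β (testDeriv φ) t) t := by
  have hφ : ContDiff ℝ 1 φ := φ.contDiff.of_le (by simp)
  rcases hβ.eq_or_lt with rfl | hβ
  · simp only [fracInt_zero]
    exact (hφ.differentiable one_ne_zero t).hasDerivAt
  have hker : LocallyIntegrable fun s => (fracKer β (-s) : ℂ) := fun x =>
    ⟨Ici (x - 1), Ici_mem_nhds (sub_one_lt x), by
      have h : IntegrableOn (fracKer β) (Iic (-(x - 1))) := integrableOn_fracKer_Iic hβ _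
      exact h.comp_neg_Ici.ofReal⟩
  rw [fracInt_eq_convolution hβ, fracInt_eq_convolution hβ]
  exact φ.hasCompactSupport.hasDerivAt_convolution_right _ hker hφ t

theorem iteratedDeriv_fracInt (hβ : 0 ≤ β) (φ : TestFn) (n : ℕ) :
    iteratedDeriv n (fracInt β φ) = fracInt β (testDeriv^[n] φ) := by
  induction n with
  | zero => simp
  | succ n ih =>
    rw [iteratedDeriv_succ, ih, Function.iterate_succ_apply']
    exact funext fun t => (hasDerivAt_fracInt hβ _ t).deriv

theorem fracInt_fracInt_testFn (hβ : 0 ≤ β) (hγ : 0 ≤ γ) (φ : TestFn) :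
    fracInt β (fracInt γ φ) = fracInt (β + γ) φ :=
  funext fun _ => fracInt_fracInt hβ hγ φ.continuous.aestronglyMeasurable
    (fracIntegrable_of_continuous (add_nonneg hβ hγ) φ.continuous φ.eventuallyEq_zero)

theorem fracInt_one_testDeriv (φ : TestFn) : fracInt 1 (testDeriv φ) = fun t => -1 * φ t := by
  funext t
  rw [fracInt_one, neg_one_mul]
  exact φ.hasCompactSupport.integral_Ioi_deriv_eq (φ.contDiff.of_le (by simp)) t

theorem fracInt_iterate_testDeriv (φ : TestFn) (n : ℕ) (t : ℝ) :
    fracInt n (testDeriv^[n] φ) t = (-1) ^ n * φ t := by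
  induction n with
  | zero => simp [fracInt_zero]
  | succ n ih =>
    rw [Nat.cast_succ, ← fracInt_fracInt_testFn n.cast_nonneg zero_le_one,
      Function.iterate_succ_apply', fracInt_one_testDeriv, fracInt_const_mul, ih]
    ring

theorem weylDeriv_eq_fracInt (α : ℝ) (φ : TestFn) :
    weylDeriv α φ = fun t => (-1) ^ ⌈α⌉₊ * fracInt (⌈α⌉₊ - α) (testDeriv^[⌈α⌉₊] φ) t := by
  funext t
  unfold weylDeriv
  split_ifs with h
  · rw [← h, sub_self, fracInt_zero, iteratedDeriv_eq_iterate_testDeriv]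
  have hβ : 0 < (⌈α⌉₊ : ℝ) - α := sub_pos.2 (lt_of_le_of_ne (Nat.le_ceil α) h)
  have hΓ : (Real.Gamma (⌈α⌉₊ - α) : ℂ) ≠ 0 := by
    exact_mod_cast (Real.Gamma_pos_of_pos hβ).ne'
  have hint : (fun r => ∫ s in Ioi r, (((s - r) ^ ((⌈α⌉₊ : ℝ) - α - 1) : ℝ) : ℂ) * φ s) =
      fun r => (Real.Gamma (⌈α⌉₊ - α) : ℂ) * fracInt (⌈α⌉₊ - α) φ r := by
    funext r
    rw [fracInt_of_pos hβ, ← integral_const_mul, ← integral_indicator measurableSet_Ioi]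
    congr with s
    by_cases hs : r < s
    · rw [indicator_of_mem (mem_Ioi.2 hs), fracKer_of_pos (sub_pos.2 hs), gFun, Complex.ofReal_div]
      field_simp
    · simp [hs, fracKer]
  rw [hint, iteratedDeriv_const_mul_field, iteratedDeriv_fracInt hβ.le]
  field_simp

theorem hasDerivAt_weylDeriv (α : ℝ) (φ : TestFn) (t : ℝ) :
    HasDerivAt (weylDeriv α φ) (weylDeriv α (testDeriv φ) t) t := by
  simp only [weylDeriv_eq_fracInt, ← Function.iterate_succ_apply, Function.iterate_succ_apply']
  exact (hasDerivAt_fracInt (ceil_sub_nonneg α) _ t).const_mul _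

@[fun_prop]
theorem continuous_weylDeriv (α : ℝ) (φ : TestFn) : Continuous (weylDeriv α φ) :=
  continuous_iff_continuousAt.2 fun t => (hasDerivAt_weylDeriv α φ t).continuousAt

theorem weylDeriv_eventuallyEq_zero (α : ℝ) (φ : TestFn) : weylDeriv α φ =ᶠ[atTop] 0 := by
  rw [weylDeriv_eq_fracInt]
  filter_upwards [fracInt_eventuallyEq_zero (β := ⌈α⌉₊ - α)
    (testDeriv^[⌈α⌉₊] φ).eventuallyEq_zero] with t ht
  simp [ht]

theorem iterate_testDeriv_eq_zero {φ : TestFn} {R : ℝ} (hR : tsupport φ ⊆ Iio R) (n : ℕ)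
    {t : ℝ} (ht : R ≤ t) : (testDeriv^[n] φ) t = 0 := by
  have hzero : iteratedFDeriv ℝ n φ t = 0 :=
    Function.notMem_support.1 fun hs => (hR (support_iteratedFDeriv_subset n hs)).not_ge ht
  rw [← iteratedDeriv_eq_iterate_testDeriv, iteratedDeriv, hzero]
  rfl

theorem weylDeriv_eq_zero (α : ℝ) {φ : TestFn} {R t : ℝ} (hR : tsupport φ ⊆ Iio R)
    (ht : R ≤ t) : weylDeriv α φ t = 0 := by
  simp only [weylDeriv_eq_fracInt]
  rw [fracInt_eq_zero fun s hs => iterate_testDeriv_eq_zero hR ⌈α⌉₊ (ht.trans hs), mul_zero]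

theorem fracInt_weylDeriv (hα : 0 ≤ α) (φ : TestFn) : fracInt α (weylDeriv α φ) = φ := by
  funext t
  rw [weylDeriv_eq_fracInt, fracInt_const_mul, fracInt_fracInt_testFn hα (ceil_sub_nonneg α),
    add_sub_cancel, fracInt_iterate_testDeriv, ← mul_assoc, ← mul_pow]
  simp

/-- The Weyl derivative of test functions as a linear map. -/
def weylDerivLM (α : ℝ) : TestFn →ₗ[ℂ] (ℝ → ℂ) where
  toFun φ := weylDeriv α φ
  map_add' φ ψ := by
    have hint (χ : TestFn) (t : ℝ) : FracIntegrable (⌈α⌉₊ - α) χ t :=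
      fracIntegrable_of_continuous (ceil_sub_nonneg α) χ.continuous χ.eventuallyEq_zero
    funext t
    have hadd : ⇑(testDeriv^[⌈α⌉₊] (φ + ψ)) = testDeriv^[⌈α⌉₊] φ + testDeriv^[⌈α⌉₊] ψ := by
      simp only [← iteratedDeriv_eq_iterate_testDeriv]
      exact funext fun s => iteratedDeriv_add (contDiff_infty.1 φ.contDiff _).contDiffAt
        (contDiff_infty.1 ψ.contDiff _).contDiffAt
    simp only [weylDeriv_eq_fracInt, Pi.add_apply, hadd]
    rw [fracInt_add (ceil_sub_nonneg α) (hint _ t) (hint _ t), mul_add]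
  map_smul' c φ := by
    have hsmul : ⇑(testDeriv^[⌈α⌉₊] (c • φ)) = fun s => c * (testDeriv^[⌈α⌉₊] φ) s := by
      simp only [← iteratedDeriv_eq_iterate_testDeriv]
      exact funext fun s => iteratedDeriv_const_mul_field c φ
    funext t
    simp only [weylDeriv_eq_fracInt, hsmul, fracInt_const_mul, RingHom.id_apply, Pi.smul_apply,
      smul_eq_mul]
    ring

end WeylDerivative

section ProductKernel

/-- Bounded integrable functions vanishing near `+∞`, such as the truncations to `(0, ∞)` of Weyl
derivatives of test functions. -/
structure IsBddCutoff (u : ℝ → ℂ) : Prop where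
  integrable : Integrable u
  bounded : ∃ M, ∀ t, ‖u t‖ ≤ M
  eventuallyEq_zero : u =ᶠ[atTop] 0

theorem isBddCutoff_indicator {u : ℝ → ℂ} (hc : Continuous u) (hu : u =ᶠ[atTop] 0) :
    IsBddCutoff ((Ioi 0).indicator u) := by
  obtain ⟨R, hR⟩ := eventually_atTop.1 hu
  have hzero : ∀ t ∉ Icc 0 R, (Ioi 0).indicator u t = 0 := fun t ht => by
    by_cases ht0 : 0 < t
    · simp [hR t (not_le.1 fun htR => ht ⟨ht0.le, htR⟩).le, indicator]
    · simp [ht0]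
  obtain ⟨M, hM⟩ := isCompact_Icc.exists_bound_of_continuousOn (hc.continuousOn (s := Icc 0 R))
  refine ⟨?_, ⟨M ⊔ 0, fun t => ?_⟩, ?_⟩
  · exact ((hc.continuousOn.integrableOn_compact isCompact_Icc).indicator
      measurableSet_Ioi).integrable_of_forall_notMem_eq_zero hzero
  · by_cases ht : t ∈ Icc 0 R
    · exact (norm_indicator_le_norm_self u t).trans ((hM t ht).trans (le_max_left _ _))
    · rw [hzero t ht, norm_zero]
      exact le_max_right _ _
  · filter_upwards [hu] with t ht
    simp [ht, indicator]

/-- On `(0, t + s)` with `t, s > 0`, the density of `∫_0^{t+s} - ∫_0^t - ∫_0^s`. -/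
def intervalSign (p : ℝ × ℝ) (r : ℝ) : ℂ :=
  1 - (Iic p.1).indicator 1 r - (Iic p.2).indicator 1 r

theorem measurable_intervalSign : Measurable (Function.uncurry intervalSign) := by
  have h₁ : Measurable fun q : (ℝ × ℝ) × ℝ => (Iic q.1.1).indicator (1 : ℝ → ℂ) q.2 :=
    (measurable_const (a := (1 : ℂ))).indicator
      (measurableSet_le measurable_snd (measurable_fst.comp measurable_fst))
  have h₂ : Measurable fun q : (ℝ × ℝ) × ℝ => (Iic q.1.2).indicator (1 : ℝ → ℂ) q.2 :=
    (measurable_const (a := (1 : ℂ))).indicator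
      (measurableSet_le measurable_snd (measurable_snd.comp measurable_fst))
  exact (measurable_const.sub h₁).sub h₂

theorem norm_intervalSign_le (p : ℝ × ℝ) (r : ℝ) : ‖intervalSign p r‖ ≤ 1 := by
  by_cases h₁ : r ≤ p.1 <;> by_cases h₂ : r ≤ p.2 <;> simp [intervalSign, h₁, h₂]

theorem measurePreserving_shear {X : Type*} [MeasurableSpace X] (μ : Measure X) [SFinite μ]
    {c : X → ℝ} (hc : Measurable c) :
    MeasurePreserving (fun q : X × ℝ => (q.1, c q.1 + q.2)) (μ.prod volume) (μ.prod volume) :=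
  (MeasurePreserving.id μ).skew_product (by fun_prop)
    (Eventually.of_forall fun x => map_add_left_eq_self volume (c x))

variable {α τ : ℝ} {u v k : ℝ → ℂ}

/-- The density in `r` of `∬ u(t) v(s) [∫_0^{t+s} - ∫_0^t - ∫_0^s] g_α(t + s - r) F(r) dr dt ds`. -/
def prodKer (α : ℝ) (u v : ℝ → ℂ) (r : ℝ) : ℂ :=
  ∫ p : ℝ × ℝ, u p.1 * v p.2 * (fracKer α (p.1 + p.2 - r) * intervalSign p r)

theorem integrable_mul_mul_sheared {K : ℝ → ℂ} (hu : IsBddCutoff u)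
    (hv : Integrable v) (hk : Integrable k) (hK : Integrable K) :
    Integrable fun q : (ℝ × ℝ) × ℝ => u q.1.1 * (v q.1.2 * k q.2 * K (q.1.1 + q.1.2 - q.2)) := by
  have hshear : Integrable fun q : (ℝ × ℝ) × ℝ => v q.1.1 * k q.1.2 * K (q.1.1 - q.1.2 + q.2) :=
    (measurePreserving_shear volume (c := fun x : ℝ × ℝ => x.1 - x.2)
      (by fun_prop)).integrable_comp_of_integrable ((hv.mul_prod hk).mul_prod hK)
  have hperm := (measurePreserving_prodAssoc (volume : Measure ℝ) (volume : Measure ℝ)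
    (volume : Measure ℝ)).integrable_comp_of_integrable hshear.swap
  obtain ⟨M, hM⟩ := hu.bounded
  refine Integrable.bdd_mul (c := M) (hperm.congr (Eventually.of_forall fun q => ?_))
    hu.integrable.aestronglyMeasurable.comp_fst.comp_fst (Eventually.of_forall fun q => hM _)
  change v q.1.2 * k q.2 * K (q.1.2 - q.2 + q.1.1) = _
  rw [sub_add_eq_add_sub, add_comm q.1.2]

theorem integrable_mul_fracKer_mul (hα : 0 < α) (hu : IsBddCutoff u) (hv : IsBddCutoff v)
    (hk : LocallyIntegrable k) (hk₀ : ∀ r ≤ 0, k r = 0) :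
    Integrable fun q : (ℝ × ℝ) × ℝ =>
      u q.1.1 * v q.1.2 * (fracKer α (q.1.1 + q.1.2 - q.2) * k q.2) := by
  obtain ⟨R₁, hR₁⟩ := eventually_atTop.1 hu.eventuallyEq_zero
  obtain ⟨R₂, hR₂⟩ := eventually_atTop.1 hv.eventuallyEq_zero
  have hk' : Integrable ((Icc 0 (R₁ + R₂)).indicator k) :=
    IntegrableOn.integrable_indicator (hk.integrableOn_isCompact isCompact_Icc) measurableSet_Icc
  have hK : Integrable fun y => (((Iic (R₁ + R₂)).indicator (fracKer α) y : ℝ) : ℂ) :=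
    ((integrableOn_fracKer_Iic hα _).integrable_indicator measurableSet_Iic).ofReal
  refine (integrable_mul_mul_sheared hu hv.integrable hk' hK).congr (Eventually.of_forall ?_)
  rintro ⟨⟨a, b⟩, r⟩
  simp only
  rcases le_or_gt R₁ a with ha | ha
  · simp [hR₁ a ha]
  rcases le_or_gt R₂ b with hb | hb
  · simp [hR₂ b hb]
  rcases le_or_gt r 0 with hr | hr
  · simp [hk₀ r hr, indicator]
  rcases le_or_gt (a + b) r with hab | hab
  · simp [fracKer_of_nonpos (sub_nonpos.2 hab), indicator]
  · rw [indicator_of_mem (mem_Icc.2 ⟨hr.le, by linarith⟩),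
      indicator_of_mem (mem_Iic.2 (by linarith))]
    ring

theorem integrable_prodKer_integrand (hα : 0 < α) (hu : IsBddCutoff u) (hv : IsBddCutoff v)
    (hk : LocallyIntegrable k) (hk₀ : ∀ r ≤ 0, k r = 0) :
    Integrable fun q : (ℝ × ℝ) × ℝ =>
      u q.1.1 * v q.1.2 * (fracKer α (q.1.1 + q.1.2 - q.2) * intervalSign q.1 q.2) * k q.2 := by
  refine ((integrable_mul_fracKer_mul hα hu hv hk hk₀).mul_bdd (c := 1)
    measurable_intervalSign.aestronglyMeasurable
    (Eventually.of_forall fun q => norm_intervalSign_le q.1 q.2)).congr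
      (Eventually.of_forall fun q => ?_)
  simp only [Function.uncurry]
  ring

theorem integrable_prodKer_mul (hα : 0 < α) (hu : IsBddCutoff u) (hv : IsBddCutoff v)
    (hk : LocallyIntegrable k) (hk₀ : ∀ r ≤ 0, k r = 0) :
    Integrable fun r => prodKer α u v r * k r := by
  refine (integrable_prodKer_integrand hα hu hv hk hk₀).integral_prod_right.congr
    (Eventually.of_forall fun r => ?_)
  simp only [prodKer, integral_mul_const]

theorem integral_prodKer_mul (hα : 0 < α) (hu : IsBddCutoff u) (hv : IsBddCutoff v)
    (hk : LocallyIntegrable k) (hk₀ : ∀ r ≤ 0, k r = 0) :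
    ∫ r, prodKer α u v r * k r = ∫ p : ℝ × ℝ, u p.1 * v p.2 *
      ∫ r, fracKer α (p.1 + p.2 - r) * k r * intervalSign p r := by
  simp only [prodKer, ← integral_mul_const, ← integral_const_mul]
  rw [← integral_integral_swap (integrable_prodKer_integrand hα hu hv hk hk₀)]
  congr! 4
  ring

theorem prodKer_eventuallyEq_zero (hu : u =ᶠ[atTop] 0) (hv : v =ᶠ[atTop] 0) :
    prodKer α u v =ᶠ[atTop] 0 := by
  obtain ⟨R₁, hR₁⟩ := eventually_atTop.1 hu
  obtain ⟨R₂, hR₂⟩ := eventually_atTop.1 hv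
  filter_upwards [eventually_ge_atTop (R₁ + R₂)] with r hr
  refine integral_eq_zero_of_ae (Eventually.of_forall fun p => ?_)
  rcases le_or_gt R₁ p.1 with h₁ | h₁
  · simp [hR₁ p.1 h₁]
  rcases le_or_gt R₂ p.2 with h₂ | h₂
  · simp [hR₂ p.2 h₂]
  · simp [fracKer_of_nonpos (show p.1 + p.2 - r ≤ 0 by linarith)]

theorem integral_mul_intervalSign_of_reflect {Q : ℝ → ℂ} {a b : ℝ} (hτ : 0 < τ)
    (hQ : Integrable Q) (hrefl : ∀ r, Q (a + b + τ - r) = Q r) :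
    ∫ r, Q r * intervalSign (a, b) r = ∫ r in Ioo a (a + τ), Q r := by
  have hswap : ∫ r, (Iic b).indicator Q r = ∫ r, (Ici (a + τ)).indicator Q r := by
    rw [← integral_sub_left_eq_self _ volume (a + b + τ)]
    congr with r
    have hmem : a + b + τ - r ∈ Iic b ↔ r ∈ Ici (a + τ) := by grind
    by_cases hr : r ∈ Ici (a + τ)
    · rw [indicator_of_mem hr, indicator_of_mem (hmem.2 hr), hrefl]
    · rw [indicator_of_notMem hr, indicator_of_notMem (hmem.not.2 hr)]
  have hsub {s : Set ℝ} (hs : MeasurableSet s) :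
      ∫ r, Q r - (Iic a).indicator Q r - s.indicator Q r =
        (∫ r, Q r - (Iic a).indicator Q r) - ∫ r, s.indicator Q r :=
    integral_sub (hQ.sub (hQ.indicator measurableSet_Iic)) (hQ.indicator hs)
  calc ∫ r, Q r * intervalSign (a, b) r
      = ∫ r, Q r - (Iic a).indicator Q r - (Iic b).indicator Q r := by
        congr with r
        by_cases ha : r ≤ a <;> by_cases hb : r ≤ b <;> simp [intervalSign, ha, hb]
    _ = ∫ r, Q r - (Iic a).indicator Q r - (Ici (a + τ)).indicator Q r := by
        rw [hsub measurableSet_Iic, hsub measurableSet_Ici, hswap]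
    _ = ∫ r in Ioo a (a + τ), Q r := by
        rw [← integral_indicator measurableSet_Ioo]
        congr with r
        by_cases ha : r ≤ a
        · simp [ha, show r < a + τ by linarith]
        · rcases lt_or_ge r (a + τ) with hb | hb
          · simp [ha, hb, hb.not_ge, not_le.1 ha]
          · simp [ha, hb, hb.not_gt]

theorem locallyIntegrable_fracKer_sub (hα : 0 < α) (τ : ℝ) :
    LocallyIntegrable fun r => (fracKer α (r - τ) : ℂ) := fun r =>
  ⟨Iic (r + 1), Iic_mem_nhds (lt_add_one r), by
    have h := ((integrableOn_fracKer_Iic hα (r + 1 - τ)).integrable_indicator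
      measurableSet_Iic).comp_sub_right τ
    refine (h.ofReal (𝕜 := ℂ)).integrableOn.congr_fun (fun s hs => ?_) measurableSet_Iic
    exact congrArg Complex.ofReal (indicator_of_mem (mem_Iic.2 (sub_le_sub_right hs τ)) _)⟩

theorem integral_fracKer_mul_fracKer_mul_intervalSign (hα : 0 < α) (hτ : 0 < τ) (p : ℝ × ℝ) :
    ∫ r, (fracKer α (p.1 + p.2 - r) : ℂ) * fracKer α (r - τ) * intervalSign p r =
      ∫ σ in Ioo 0 τ, (fracKer α (p.1 - (τ - σ)) : ℂ) * fracKer α (p.2 - σ) := by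
  obtain ⟨a, b⟩ := p
  have hQ : Integrable fun r => (fracKer α (a + b - r) : ℂ) * fracKer α (r - τ) :=
    (integrable_fracKer_mul_fracKer hα hα τ (a + b)).ofReal.congr
      (Eventually.of_forall fun r => by simp [mul_comm])
  calc _ = ∫ r in Ioo a (a + τ), (fracKer α (a + b - r) : ℂ) * fracKer α (r - τ) :=
        integral_mul_intervalSign_of_reflect hτ hQ fun r => by
          rw [mul_comm, show a + b + τ - r - τ = a + b - r by ring,
            show a + b - (a + b + τ - r) = r - τ by ring]
    _ = ∫ σ in Ioo 0 τ, (fracKer α (a - (τ - σ)) : ℂ) * fracKer α (b - σ) := by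
        have hshift := (measurePreserving_add_left volume a).setIntegral_preimage_emb
          (measurableEmbedding_addLeft a)
          (fun r => (fracKer α (a + b - r) : ℂ) * fracKer α (r - τ)) (Ioo a (a + τ))
        simp only [preimage_const_add_Ioo, sub_self, add_sub_cancel_left] at hshift
        rw [← hshift]
        congr with σ
        rw [mul_comm, add_sub_add_left_eq_sub, sub_sub_eq_add_sub]

theorem fracInt_prodKer (hα : 0 < α) (hu : IsBddCutoff u) (hv : IsBddCutoff v) (hτ : 0 < τ) :
    fracInt α (prodKer α u v) τ = ∫ σ in Ioo 0 τ, fracInt α u (τ - σ) * fracInt α v σ := by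
  have hk := locallyIntegrable_fracKer_sub hα τ
  have hk₀ : ∀ r ≤ 0, (fracKer α (r - τ) : ℂ) = 0 := fun r hr => by
    rw [fracKer_of_nonpos (by linarith), Complex.ofReal_zero]
  have hint : Integrable fun q : (ℝ × ℝ) × ℝ =>
      u q.1.1 * v q.1.2 * (fracKer α (q.1.1 - (τ - q.2)) * fracKer α (q.1.2 - q.2)) := by
    refine ((measurePreserving_shear volume (c := fun p : ℝ × ℝ => p.1)
      measurable_fst).integrable_comp_of_integrable
        (integrable_mul_fracKer_mul hα hu hv hk hk₀)).congr (Eventually.of_forall fun q => ?_)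
    simp only [Function.comp_apply]
    rw [mul_comm (fracKer α (q.1.1 - (τ - q.2)) : ℂ), add_sub_add_left_eq_sub,
      sub_sub_eq_add_sub]
  calc fracInt α (prodKer α u v) τ
      = ∫ r, prodKer α u v r * fracKer α (r - τ) := by
        simp only [fracInt_of_pos hα, mul_comm]
    _ = ∫ p : ℝ × ℝ, ∫ σ in Ioo 0 τ,
          u p.1 * v p.2 * (fracKer α (p.1 - (τ - σ)) * fracKer α (p.2 - σ)) := by
        rw [integral_prodKer_mul hα hu hv hk hk₀]
        simp only [integral_fracKer_mul_fracKer_mul_intervalSign hα hτ, integral_const_mul]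
    _ = ∫ σ in Ioo 0 τ, ∫ p : ℝ × ℝ,
          (fracKer α (p.1 - (τ - σ)) * u p.1) * (fracKer α (p.2 - σ) * v p.2) := by
        rw [integral_integral_swap (hint.mono_measure
          (Measure.prod_mono le_rfl Measure.restrict_le_self))]
        congr! 4
        ring
    _ = ∫ σ in Ioo 0 τ, fracInt α u (τ - σ) * fracInt α v σ := by
        simp only [fracInt_of_pos hα]
        congr with σ
        exact integral_prod_mul (fun a => (fracKer α (a - (τ - σ)) : ℂ) * u a)
          (fun b => (fracKer α (b - σ) : ℂ) * v b)

end ProductKernel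

section ProductFormula

variable {α τ : ℝ} {F : ℝ → ℂ}

theorem isBddCutoff_weylDeriv (α : ℝ) (φ : TestFn) :
    IsBddCutoff ((Ioi 0).indicator (weylDeriv α φ)) :=
  isBddCutoff_indicator (continuous_weylDeriv α φ) (weylDeriv_eventuallyEq_zero α φ)

theorem fracInt_indicator_weylDeriv (hα : 0 < α) (φ : TestFn) (hτ : 0 ≤ τ) :
    fracInt α ((Ioi 0).indicator (weylDeriv α φ)) τ = φ τ := by
  rw [← congrFun (fracInt_weylDeriv hα.le φ) τ]
  exact fracInt_congr_Ioi hα fun s hs => indicator_of_mem (hτ.trans_lt hs) _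

theorem fracInt_prodKer_weylDeriv (hα : 0 < α) (φ ψ : TestFn) (hτ : 0 < τ) :
    fracInt α (prodKer α ((Ioi 0).indicator (weylDeriv α φ))
      ((Ioi 0).indicator (weylDeriv α ψ))) τ = conv0 φ ψ τ := by
  rw [fracInt_prodKer hα (isBddCutoff_weylDeriv α φ) (isBddCutoff_weylDeriv α ψ) hτ, conv0_apply,
    intervalIntegral.integral_of_le hτ.le, integral_Ioc_eq_integral_Ioo]
  refine setIntegral_congr_fun measurableSet_Ioo fun σ hσ => ?_
  simp only [fracInt_indicator_weylDeriv hα φ (sub_nonneg.2 hσ.2.le),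
    fracInt_indicator_weylDeriv hα ψ hσ.1.le]

theorem prodKer_ae_eq_weylDeriv_conv0 (hα : 0 < α) (φ ψ : TestFn) :
    ∀ᵐ r, 0 < r → prodKer α ((Ioi 0).indicator (weylDeriv α φ))
      ((Ioi 0).indicator (weylDeriv α ψ)) r = weylDeriv α (conv0 φ ψ) r := by
  have hφ := isBddCutoff_weylDeriv α φ
  have hψ := isBddCutoff_weylDeriv α ψ
  set P := prodKer α ((Ioi 0).indicator (weylDeriv α φ)) ((Ioi 0).indicator (weylDeriv α ψ))
  have hP : Integrable ((Ioi 0).indicator P) := by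
    have hone : LocallyIntegrable ((Ioi (0 : ℝ)).indicator (1 : ℝ → ℂ)) :=
      (locallyIntegrable_const 1).indicator measurableSet_Ioi
    refine (integrable_prodKer_mul hα hφ hψ hone fun r hr => by simp [hr]).congr
      (Eventually.of_forall fun r => ?_)
    by_cases hr : 0 < r <;> simp [hr, P]
  have hP₀ : (Ioi 0).indicator P =ᶠ[atTop] 0 := by
    filter_upwards [prodKer_eventuallyEq_zero (α := α) hφ.eventuallyEq_zero
      hψ.eventuallyEq_zero] with r hr
    simp [P, hr, indicator]
  have hPint : ∀ t > 0, FracIntegrable α ((Ioi 0).indicator P) t := fun t ht => by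
    refine (integrable_prodKer_mul hα hφ hψ (locallyIntegrable_fracKer_sub hα t) fun r hr => by
      rw [fracKer_of_nonpos (by linarith), Complex.ofReal_zero]).congr
        (Eventually.of_forall fun r => ?_)
    by_cases hr : 0 < r
    · simp [hr, P, mul_comm]
    · simp [hr, fracKer_of_nonpos (show r - t ≤ 0 by linarith)]
  filter_upwards [ae_eq_of_fracInt_eq hα hP.locallyIntegrable hP₀ hPint
    (continuous_weylDeriv α (conv0 φ ψ)) (weylDeriv_eventuallyEq_zero α _) fun t ht => by
      rw [fracInt_weylDeriv hα.le, ← fracInt_prodKer_weylDeriv hα φ ψ ht]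
      exact fracInt_congr_Ioi hα fun r hr => indicator_of_mem (ht.trans hr) _] with r hr hr₀
  rw [← hr hr₀, indicator_of_mem (mem_Ioi.2 hr₀)]

theorem locallyIntegrable_indicator_Ioi (hF : ContinuousOn F (Ici 0)) :
    LocallyIntegrable ((Ioi 0).indicator F) := by
  refine locallyIntegrable_iff.2 fun K hK => ?_
  rw [integrableOn_indicator_iff measurableSet_Ioi]
  exact ((hF.mono inter_subset_left).integrableOn_compact (hK.inter_left isClosed_Ici)).mono_set
    (inter_subset_inter_left K Ioi_subset_Ici_self)

theorem integral_fracKer_mul_intervalSign {t s : ℝ} (ht : 0 < t) (hs : 0 < s)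
    (hF : IntegrableOn (fun r => (gFun α (t + s - r) : ℂ) * F r) (Ioc 0 (t + s))) :
    ∫ r, (fracKer α (t + s - r) : ℂ) * (Ioi 0).indicator F r * intervalSign (t, s) r =
      (∫ r in Ioc 0 (t + s), (gFun α (t + s - r) : ℂ) * F r) -
        (∫ r in Ioc 0 t, (gFun α (t + s - r) : ℂ) * F r) -
        ∫ r in Ioc 0 s, (gFun α (t + s - r) : ℂ) * F r := by
  set q : ℝ → ℂ := fun r => (gFun α (t + s - r) : ℂ) * F r
  have hind {b : ℝ} (hb : b ≤ t + s) : Integrable ((Ioc 0 b).indicator q) :=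
    (hF.mono_set (Ioc_subset_Ioc_right hb)).integrable_indicator measurableSet_Ioc
  have hpos : Integrable ((Ioo 0 (t + s)).indicator q) :=
    (hF.mono_set Ioo_subset_Ioc_self).integrable_indicator measurableSet_Ioo
  have ht' : t < t + s := by linarith
  have hs' : s < t + s := by linarith
  have hset (b : ℝ) : ∫ r in Ioc 0 b, q r = ∫ r, (Ioc 0 b).indicator q r :=
    (integral_indicator measurableSet_Ioc).symm
  rw [hset t, hset s, integral_Ioc_eq_integral_Ioo, ← integral_indicator measurableSet_Ioo,
    ← integral_sub' hpos (hind ht'.le), ← integral_sub' (hpos.sub (hind ht'.le)) (hind hs'.le)]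
  congr with r
  rcases le_or_gt r 0 with hr | hr
  · simp [indicator, hr.not_gt]
  rcases le_or_gt (t + s) r with hr' | hr'
  · have hrt := (ht'.trans_le hr').not_ge
    have hrs := (hs'.trans_le hr').not_ge
    simp [fracKer_of_nonpos (sub_nonpos.2 hr'), hr'.not_gt, hrt, hrs]
  · by_cases hrt : r ≤ t <;> by_cases hrs : r ≤ s <;>
      simp [q, intervalSign, fracKer, hr, hr', hrt, hrs]

theorem integral_weylDeriv_conv0 (hα : 0 < α) (φ ψ : TestFn) (hF : ContinuousOn F (Ici 0))
    {Φ : ℝ → ℝ → ℂ}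
    (hint : ∀ t > 0, ∀ s > 0, IntegrableOn (fun r => (gFun α (t + s - r) : ℂ) * F r)
      (Ioc 0 (t + s)))
    (hΦ : ∀ t > 0, ∀ s > 0, Φ t s =
      (∫ r in Ioc 0 (t + s), (gFun α (t + s - r) : ℂ) * F r) -
        (∫ r in Ioc 0 t, (gFun α (t + s - r) : ℂ) * F r) -
        ∫ r in Ioc 0 s, (gFun α (t + s - r) : ℂ) * F r) :
    ∫ r in Ioi 0, weylDeriv α (conv0 φ ψ) r * F r =
      ∫ t in Ioi 0, weylDeriv α φ t * ∫ s in Ioi 0, weylDeriv α ψ s * Φ t s := by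
  have hφ := isBddCutoff_weylDeriv α φ
  have hψ := isBddCutoff_weylDeriv α ψ
  have hk := locallyIntegrable_indicator_Ioi hF
  have hk₀ : ∀ r ≤ 0, (Ioi 0).indicator F r = 0 := fun r hr => indicator_of_notMem hr.not_gt _
  set u := (Ioi 0).indicator (weylDeriv α φ)
  set v := (Ioi 0).indicator (weylDeriv α ψ)
  set k := (Ioi 0).indicator F
  calc ∫ r in Ioi 0, weylDeriv α (conv0 φ ψ) r * F r
      = ∫ r, prodKer α u v r * k r := by
        rw [← integral_indicator measurableSet_Ioi]
        refine integral_congr_ae ?_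
        filter_upwards [prodKer_ae_eq_weylDeriv_conv0 hα φ ψ] with r hr
        by_cases hr₀ : 0 < r
        · simp [k, u, v, hr₀, hr hr₀]
        · simp [k, hr₀]
    _ = ∫ t, ∫ s, u t * v s * ∫ r, fracKer α (t + s - r) * k r * intervalSign (t, s) r := by
        rw [integral_prodKer_mul hα hφ hψ hk hk₀]
        refine integral_prod _ ((integrable_prodKer_integrand hα hφ hψ hk
          hk₀).integral_prod_left.congr (Eventually.of_forall fun p => ?_))
        simp only [← integral_const_mul]
        congr with r
        ring
    _ = ∫ t in Ioi 0, weylDeriv α φ t * ∫ s in Ioi 0, weylDeriv α ψ s * Φ t s := by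
        simp only [← integral_indicator measurableSet_Ioi, mul_assoc, integral_const_mul]
        congr with t
        by_cases ht : 0 < t
        swap
        · simp [u, ht]
        rw [indicator_of_mem (mem_Ioi.2 ht)]
        congr 1
        · exact indicator_of_mem (mem_Ioi.2 ht) _
        congr with s
        by_cases hs : 0 < s
        · simp only [v, indicator_of_mem (mem_Ioi.2 hs)]
          rw [hΦ t ht s hs, ← integral_fracKer_mul_intervalSign ht hs (hint t ht s hs)]
          simp only [mul_assoc, k]
        · simp [v, hs]

theorem integrableOn_mul_mul_comp_add (φ ψ : TestFn) (hF : ContinuousOn F (Ici 0)) :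
    IntegrableOn (fun p : ℝ × ℝ => φ p.1 * ψ p.2 * F (p.1 + p.2)) (Ioi 0 ×ˢ Ioi 0) := by
  obtain ⟨R₁, hR₁⟩ := eventually_atTop.1 φ.eventuallyEq_zero
  obtain ⟨R₂, hR₂⟩ := eventually_atTop.1 ψ.eventuallyEq_zero
  have hcont : ContinuousOn (fun p : ℝ × ℝ => φ p.1 * ψ p.2 * F (p.1 + p.2))
      (Icc 0 R₁ ×ˢ Icc 0 R₂) :=
    ContinuousOn.mul (by fun_prop) <| hF.comp (by fun_prop) fun p hp =>
      add_nonneg hp.1.1 hp.2.1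
  refine (hcont.integrableOn_compact (isCompact_Icc.prod isCompact_Icc)).of_forall_sdiff_eq_zero
    (measurableSet_Ioi.prod measurableSet_Ioi) fun p ⟨hp, hpR⟩ => ?_
  rcases le_or_gt R₁ p.1 with h₁ | h₁
  · simp [hR₁ p.1 h₁]
  rcases le_or_gt R₂ p.2 with h₂ | h₂
  · simp [hR₂ p.2 h₂]
  · exact absurd ⟨⟨le_of_lt hp.1, h₁.le⟩, ⟨le_of_lt hp.2, h₂.le⟩⟩ hpR

theorem conv0_eq_integral_indicator (φ ψ : TestFn) {r : ℝ} (hr : 0 < r) :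
    conv0 φ ψ r = ∫ t, (Ioi 0).indicator φ t * (Ioi 0).indicator ψ (r - t) := by
  rw [conv0_apply, ← integral_sub_left_eq_self _ volume r, intervalIntegral.integral_of_le hr.le,
    integral_Ioc_eq_integral_Ioo, ← integral_indicator measurableSet_Ioo]
  congr with s
  by_cases hs : 0 < s <;> by_cases hsr : s < r <;> simp [hs, hsr]

theorem integral_conv0 (φ ψ : TestFn) (hF : ContinuousOn F (Ici 0)) :
    ∫ r in Ioi 0, conv0 φ ψ r * F r =
      ∫ t in Ioi 0, φ t * ∫ s in Ioi 0, ψ s * F (t + s) := by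
  set u := (Ioi 0).indicator φ
  set v := (Ioi 0).indicator ψ
  have hint : Integrable fun p : ℝ × ℝ => u p.1 * v p.2 * F (p.1 + p.2) := by
    refine ((integrableOn_mul_mul_comp_add φ ψ hF).integrable_indicator
      (measurableSet_Ioi.prod measurableSet_Ioi)).congr (Eventually.of_forall fun p => ?_)
    by_cases h₁ : 0 < p.1 <;> by_cases h₂ : 0 < p.2 <;> simp [u, v, h₁, h₂]
  have hshear : Integrable fun p : ℝ × ℝ => u p.1 * v (p.2 - p.1) * F p.2 := by
    refine ((measurePreserving_shear volume (c := Neg.neg)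
      measurable_neg).integrable_comp_of_integrable hint).congr (Eventually.of_forall fun p => ?_)
    simp [neg_add_eq_sub]
  calc ∫ r in Ioi 0, conv0 φ ψ r * F r
      = ∫ r, ∫ t, u t * v (r - t) * F r := by
        rw [← integral_indicator measurableSet_Ioi]
        congr with r
        rw [integral_mul_const]
        by_cases hr : 0 < r
        · simp [hr, conv0_eq_integral_indicator φ ψ hr, u, v]
        · have hzero : ∀ t, u t * v (r - t) = 0 := fun t => by
            by_cases ht : 0 < t
            · simp [v, show r ≤ t by linarith]
            · simp [u, ht]
          simp [hr, hzero]
    _ = ∫ t, ∫ r, u t * v (r - t) * F r := integral_integral_swap hshear.swap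
    _ = ∫ t, ∫ s, u t * v s * F (t + s) := by
        congr with t
        rw [← integral_add_left_eq_self _ t]
        simp only [add_sub_cancel_left]
    _ = ∫ t in Ioi 0, φ t * ∫ s in Ioi 0, ψ s * F (t + s) := by
        simp only [← integral_indicator measurableSet_Ioi, mul_assoc, integral_const_mul]
        congr with t
        by_cases ht : 0 < t
        · simp only [u, v, indicator_of_mem (mem_Ioi.2 ht), indicator_mul_left]
        · simp [u, ht]

end ProductFormula

section LocallyConvex

open ComplexOrder in
theorem locallyConvexSpace_complex (E : Type*) [AddCommGroup E] [Module ℂ E] [Module ℝ E]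
    [IsScalarTower ℝ ℂ E] [TopologicalSpace E] [LocallyConvexSpace ℝ E] :
    LocallyConvexSpace ℂ E :=
  LocallyConvexSpace.ofBases ℂ E (fun _ => id) (fun x s => s ∈ 𝓝 x ∧ Convex ℝ s)
    LocallyConvexSpace.convex_basis fun _ _ hs => convex_of_nonneg_surjective_algebraMap _
      (fun _ h => RCLike.nonneg_iff_exists_ofReal.mp h) hs.2

theorem polynormableSpace_of_real (E : Type*) [AddCommGroup E] [Module ℂ E] [Module ℝ E]
    [IsScalarTower ℝ ℂ E] [TopologicalSpace E] [IsTopologicalAddGroup E] [ContinuousSMul ℂ E]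
    [LocallyConvexSpace ℝ E] : PolynormableSpace ℂ E := by
  have := locallyConvexSpace_complex E
  have : ContinuousSMul ℝ E := IsScalarTower.continuousSMul ℂ
  exact LocallyConvexSpace.toPolynormableSpace

variable {E : Type*} [AddCommGroup E] [Module ℂ E] [TopologicalSpace E]

theorem exists_dual_eq_seminorm [PolynormableSpace ℂ E] {p : Seminorm ℂ E} (hp : Continuous p)
    (v : E) : ∃ f : E →L[ℂ] ℂ, f v = p v ∧ ∀ x, ‖f x‖ ≤ p x := by
  rcases eq_or_ne v 0 with rfl | hv
  · exact ⟨0, by simp, fun x => by simp⟩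
  let coord : Submodule.span ℂ {v} →ₗ[ℂ] ℂ := LinearEquiv.coord ℂ E v hv
  have hnorm (x : Submodule.span ℂ {v}) : ‖((p v : ℂ) • coord) x‖ ≤ p x := by
    have hx : p x = ‖coord x‖ * p v := by
      rw [← map_smul_eq_mul]
      exact congrArg p (LinearEquiv.coord_apply_smul ℂ E v hv x).symm
    simp [hx, abs_of_nonneg (apply_nonneg p v), mul_comm]
  obtain ⟨f, hf, hle⟩ := Module.Dual.exists_continuous_extension_of_le_seminorm _
    ((p v : ℂ) • coord) hp hnorm
  refine ⟨f, ?_, hle⟩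
  rw [hf ⟨v, Submodule.mem_span_singleton_self v⟩]
  simp [coord, LinearEquiv.coord_self ℂ E v hv]

theorem exists_seminorm_ball_subset [PolynormableSpace ℂ E] {V : Set E} (hV : V ∈ 𝓝 (0 : E)) :
    ∃ p : Seminorm ℂ E, Continuous p ∧ ∃ r > 0, p.ball 0 r ⊆ V := by
  have hw := PolynormableSpace.withSeminorms ℂ E
  obtain ⟨s, r, hr, hs⟩ := (hw.mem_nhds_iff _ _).1 hV
  refine ⟨_, ?_, r, hr, hs⟩
  have := hw.topologicalAddGroup
  exact Seminorm.continuous_finsetSup fun p _ => p.2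

theorem exists_seminorm_comp_le_of_isCompact [BarrelledSpace ℂ E]
    {F : Type*} [AddCommGroup F] [Module ℂ F] [TopologicalSpace F]
    {X : Type*} [TopologicalSpace X] {K : Set X} (hK : IsCompact K) {T : X → E →L[ℂ] F}
    (hT : ∀ x, ContinuousOn (fun t => T t x) K) {p : Seminorm ℂ F} (hp : Continuous p) :
    ∃ q : Seminorm ℂ E, Continuous q ∧ ∀ t ∈ K, ∀ x, p (T t x) ≤ q x := by
  let P (t : K) : Seminorm ℂ E := p.comp (T t).toLinearMap
  have hbdd : BddAbove (range P) := by
    rw [Seminorm.bddAbove_range_iff]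
    intro x
    have := hK.bddAbove_image (hp.comp_continuousOn (hT x))
    rwa [image_eq_range] at this
  refine ⟨⨆ t, P t, ?_, fun t ht => le_ciSup hbdd ⟨t, ht⟩⟩
  rw [Seminorm.coe_iSup_eq hbdd]
  exact Seminorm.continuous_iSup P (fun t => hp.comp (T t).continuous) hbdd

end LocallyConvex

section VectorIntegral

variable {E : Type*} [AddCommGroup E] [Module ℂ E] [TopologicalSpace E]
  {F G : ℝ → E} {s t : Set ℝ} {v w : E}

theorem HasVectorIntegral.congr (hs : MeasurableSet s) (hF : HasVectorIntegral F s v)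
    (h : EqOn F G s) : HasVectorIntegral G s v := fun f =>
  have hfs : EqOn (fun t => f (F t)) (fun t => f (G t)) s := fun _ ht => congrArg f (h ht)
  ⟨(hF f).1.congr_fun hfs hs, by rw [← setIntegral_congr_fun hs hfs, (hF f).2]⟩

theorem HasVectorIntegral.map (hF : HasVectorIntegral F s v) (T : E →L[ℂ] E) :
    HasVectorIntegral (fun t => T (F t)) s (T v) := fun f => hF (f.comp T)

theorem hasVectorIntegral_zero (s : Set ℝ) : HasVectorIntegral (fun _ => (0 : E)) s 0 :=
  fun f => by simp

theorem hasVectorIntegral_iff_of_subset (ht : MeasurableSet t) (hst : s ⊆ t)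
    (hF : ∀ r ∈ t \ s, F r = 0) : HasVectorIntegral F s v ↔ HasVectorIntegral F t v := by
  refine forall_congr' fun f => ?_
  have hz : ∀ r ∈ t \ s, f (F r) = 0 := fun r hr => by rw [hF r hr, map_zero]
  rw [setIntegral_eq_of_subset_of_forall_sdiff_eq_zero ht hst hz]
  exact and_congr_left' ⟨fun h => h.of_forall_sdiff_eq_zero ht hz, fun h => h.mono_set hst⟩

variable [PolynormableSpace ℂ E]

theorem HasVectorIntegral.unique [T2Space E] (hv : HasVectorIntegral F s v)
    (hw : HasVectorIntegral F s w) : v = w := by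
  by_contra hne
  obtain ⟨p, hp⟩ := (PolynormableSpace.withSeminorms ℂ E).separating_of_T1 (v - w)
    (sub_ne_zero.2 hne)
  obtain ⟨f, hf, -⟩ := exists_dual_eq_seminorm p.2 (v - w)
  rw [map_sub, ← (hv f).2, ← (hw f).2, sub_self] at hf
  exact hp (mod_cast hf.symm)

theorem HasVectorIntegral.seminorm_le (hF : HasVectorIntegral F s v) (hs : volume s < ⊤)
    {p : Seminorm ℂ E} (hp : Continuous p) {M : ℝ} (hM : ∀ t ∈ s, p (F t) ≤ M) :
    p v ≤ M * volume.real s := by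
  obtain ⟨f, hfv, hf⟩ := exists_dual_eq_seminorm hp v
  calc p v = ‖∫ t in s, f (F t)‖ := by
        rw [(hF f).2, hfv, Complex.norm_real, Real.norm_of_nonneg (apply_nonneg p v)]
    _ ≤ M * volume.real s :=
        norm_setIntegral_le_of_norm_le_const hs fun t ht => (hf _).trans (hM t ht)

end VectorIntegral

section RiemannSum

/-- The left Riemann sum of a vector-valued function `F` over `[0, b]` with `N` equal parts. -/
def riemannSum {E : Type*} [AddCommGroup E] [Module ℂ E] (b : ℝ) (F : ℝ → E) (N : ℕ) : E :=
  ((b / N : ℝ) : ℂ) • ∑ i ∈ Finset.range N, F (i * (b / N))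

theorem map_riemannSum {E : Type*} [AddCommGroup E] [Module ℂ E] [TopologicalSpace E]
    (f : E →L[ℂ] ℂ) (b : ℝ) (F : ℝ → E) (N : ℕ) :
    f (riemannSum b F N) = riemannSum b (fun t => f (F t)) N := by
  simp only [riemannSum, map_smul, map_sum]

theorem mul_div_mem_Icc {b : ℝ} (hb : 0 ≤ b) {i N : ℕ} (hi : i ≤ N) :
    (i : ℝ) * (b / N) ∈ Icc 0 b := by
  have hle : (i : ℝ) / N ≤ 1 := div_le_one_of_le₀ (mod_cast hi) N.cast_nonneg
  exact ⟨by positivity, by rw [mul_div_left_comm]; exact mul_le_of_le_one_right hb hle⟩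

theorem integral_sub_riemannSum {g : ℝ → ℂ} {b : ℝ} (hb : 0 ≤ b)
    (hg : IntervalIntegrable g volume 0 b) {N : ℕ} (hN : N ≠ 0) :
    (∫ t in Ioc 0 b, g t) - riemannSum b g N = ∑ i ∈ Finset.range N,
      ∫ t in (i * (b / N))..((i + 1 : ℕ) * (b / N)), (g t - g (i * (b / N))) := by
  have hint {i : ℕ} (hi : i < N) :
      IntervalIntegrable g volume (i * (b / N)) ((i + 1 : ℕ) * (b / N)) := by
    refine hg.mono_set (uIcc_subset_uIcc ?_ ?_) <;> rw [uIcc_of_le hb]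
    exacts [mul_div_mem_Icc hb hi.le, mul_div_mem_Icc hb hi]
  have hsum := intervalIntegral.sum_integral_adjacent_intervals (f := g) (μ := volume)
    (a := fun i : ℕ => (i : ℝ) * (b / N)) fun i hi => hint hi
  rw [Nat.cast_zero, zero_mul, mul_div_cancel₀ b (Nat.cast_ne_zero.2 hN),
    intervalIntegral.integral_of_le hb] at hsum
  rw [← hsum, riemannSum, Finset.smul_sum, ← Finset.sum_sub_distrib]
  refine Finset.sum_congr rfl fun i hi => ?_
  rw [intervalIntegral.integral_sub (hint (Finset.mem_range.1 hi)) (by simp),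
    intervalIntegral.integral_const, ← sub_mul, Nat.cast_succ, add_sub_cancel_left, one_mul,
    Complex.real_smul, smul_eq_mul]

theorem norm_integral_sub_riemannSum_le {g : ℝ → ℂ} {b ε : ℝ} (hb : 0 ≤ b)
    (hg : ContinuousOn g (Icc 0 b)) {N : ℕ} (hN : N ≠ 0)
    (hε : ∀ s ∈ Icc 0 b, ∀ t ∈ Icc 0 b, |t - s| ≤ b / N → ‖g t - g s‖ ≤ ε) :
    ‖(∫ t in Ioc 0 b, g t) - riemannSum b g N‖ ≤ b * ε := by
  have hlength (i : ℕ) : ((i + 1 : ℕ) : ℝ) * (b / N) - i * (b / N) = b / N := by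
    push_cast
    ring
  have hstep : 0 ≤ b / N := by positivity
  have hpart (i : ℕ) (hi : i ∈ Finset.range N) :
      ‖∫ t in (i * (b / N))..((i + 1 : ℕ) * (b / N)), (g t - g (i * (b / N)))‖ ≤
        ε * (b / N) := by
    have hi := Finset.mem_range.1 hi
    have hbound : ∀ t ∈ uIoc (i * (b / N)) ((i + 1 : ℕ) * (b / N)),
        ‖g t - g (i * (b / N))‖ ≤ ε := by
      intro t ht
      rw [uIoc_of_le (by linarith [hlength i])] at ht
      have ht' := Icc_subset_Icc (mul_div_mem_Icc hb hi.le).1 (mul_div_mem_Icc hb hi).2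
        (Ioc_subset_Icc_self ht)
      refine hε _ (mul_div_mem_Icc hb hi.le) _ ht' ?_
      rw [abs_of_pos (sub_pos.2 ht.1)]
      linarith [ht.2, hlength i]
    have := intervalIntegral.norm_integral_le_of_norm_le_const hbound
    rwa [hlength, abs_of_nonneg hstep] at this
  rw [integral_sub_riemannSum hb (hg.intervalIntegrable_of_Icc hb) hN]
  calc _ ≤ ∑ _i ∈ Finset.range N, ε * (b / N) := norm_sum_le_of_le _ hpart
    _ = b * ε := by
        rw [Finset.sum_const, Finset.card_range, nsmul_eq_mul]
        field_simp

end RiemannSum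

section Existence

variable {E : Type*} [AddCommGroup E] [Module ℂ E] [UniformSpace E] [IsUniformAddGroup E]

theorem exists_pos_forall_seminorm_sub_le {X : Type*} [PseudoMetricSpace X] {K : Set X}
    (hK : IsCompact K) {F : X → E} (hF : ContinuousOn F K) {p : Seminorm ℂ E} (hp : Continuous p)
    {ε : ℝ} (hε : 0 < ε) :
    ∃ δ > 0, ∀ s ∈ K, ∀ t ∈ K, dist t s < δ → p (F t - F s) ≤ ε := by
  have hV : {q : E × E | p (q.2 - q.1) < ε} ∈ uniformity E := by
    rw [uniformity_eq_comap_nhds_zero]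
    exact ⟨p.ball 0 ε, p.ball_mem_nhds hp hε, fun q hq => p.mem_ball_zero.1 hq⟩
  have hu := hK.uniformContinuousOn_of_continuous hF
  obtain ⟨δ, hδ, h⟩ := (Metric.uniformity_basis_dist.inf_principal _).tendsto_left_iff.1 hu _ hV
  refine ⟨δ, hδ, fun s hs t ht hst => le_of_lt ?_⟩
  exact @h (s, t) ⟨by rwa [mem_ofPred, dist_comm], hs, ht⟩

variable {F : ℝ → E} {b : ℝ}

theorem eventually_norm_integral_sub_riemannSum_le (hb : 0 ≤ b) (hF : ContinuousOn F (Icc 0 b))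
    {p : Seminorm ℂ E} (hp : Continuous p) {ε : ℝ} (hε : 0 < ε) :
    ∀ᶠ N in atTop, ∀ f : E →L[ℂ] ℂ, (∀ x, ‖f x‖ ≤ p x) →
      ‖(∫ t in Ioc 0 b, f (F t)) - f (riemannSum b F N)‖ ≤ b * ε := by
  obtain ⟨δ, hδ, hmod⟩ := exists_pos_forall_seminorm_sub_le isCompact_Icc hF hp hε
  filter_upwards [(tendsto_const_div_atTop_nhds_zero_nat b).eventually_lt_const hδ,
    eventually_ne_atTop 0] with N hNδ hN f hf
  rw [map_riemannSum]
  refine norm_integral_sub_riemannSum_le hb (f.continuous.comp_continuousOn hF) hN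
    fun s hs t ht hst => ?_
  rw [Function.comp_apply, Function.comp_apply, ← map_sub]
  exact (hf _).trans (hmod s hs t ht (hst.trans_lt hNδ))

theorem cauchySeq_riemannSum [PolynormableSpace ℂ E] (hb : 0 ≤ b)
    (hF : ContinuousOn F (Icc 0 b)) : CauchySeq (riemannSum b F) := by
  rw [cauchySeq_iff_tendsto, uniformity_eq_comap_nhds_zero, tendsto_comap_iff,
    (PolynormableSpace.withSeminorms ℂ E).tendsto_nhds, ← prod_atTop_atTop_eq]
  rintro ⟨p, hp⟩ ε hε
  have hev := eventually_norm_integral_sub_riemannSum_le hb hF hp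
    (ε := ε / (2 * (b + 1))) (by positivity)
  filter_upwards [hev.prod_mk hev] with ⟨N, M⟩ ⟨hN, hM⟩
  -- A Hahn-Banach functional `f` reduces the claim to a scalar estimate, uniform in `|f| ≤ p`.
  obtain ⟨f, hfv, hf⟩ := exists_dual_eq_seminorm hp (riemannSum b F M - riemannSum b F N)
  simp only [Function.comp, Prod.map, sub_zero]
  set I := ∫ t in Ioc 0 b, f (F t)
  calc p (riemannSum b F M - riemannSum b F N)
      = ‖(I - f (riemannSum b F N)) - (I - f (riemannSum b F M))‖ := by
        rw [sub_sub_sub_cancel_left, ← map_sub, hfv, Complex.norm_real,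
          Real.norm_of_nonneg (apply_nonneg p _)]
    _ ≤ b * (ε / (2 * (b + 1))) + b * (ε / (2 * (b + 1))) :=
        (norm_sub_le _ _).trans (add_le_add (hN f hf) (hM f hf))
    _ < ε := by
        field_simp
        linarith

theorem hasVectorIntegral_of_tendsto_riemannSum (hb : 0 ≤ b) (hF : ContinuousOn F (Icc 0 b))
    {v : E} (hv : Tendsto (riemannSum b F) atTop (𝓝 v)) :
    HasVectorIntegral F (Ioc 0 b) v := by
  intro f
  have hf := f.continuous.comp_continuousOn hF
  refine ⟨hf.integrableOn_Icc.mono_set Ioc_subset_Icc_self, ?_⟩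
  have hlim := ((f.continuous.tendsto v).comp hv).const_sub (∫ t in Ioc 0 b, f (F t))
  have hle : ∀ ε > 0, ‖(∫ t in Ioc 0 b, f (F t)) - f v‖ ≤ b * ε := fun ε hε =>
    le_of_tendsto hlim.norm <|
      (eventually_norm_integral_sub_riemannSum_le hb hF (p := f.toSeminorm) f.continuous.norm
        hε).mono fun N hN => hN f fun x => le_rfl
  have hzero : Tendsto (fun ε : ℝ => b * ε) (𝓝[>] 0) (𝓝 0) :=
    ((continuous_const_mul b).tendsto' 0 0 (mul_zero b)).mono_left nhdsWithin_le_nhds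
  exact sub_eq_zero.1 <| norm_le_zero_iff.1 <|
    ge_of_tendsto hzero (eventually_mem_nhdsWithin.mono hle)

theorem exists_hasVectorIntegral [PolynormableSpace ℂ E]
    (hE : ∀ u : ℕ → E, CauchySeq u → ∃ x : E, Tendsto u atTop (𝓝 x)) (hb : 0 ≤ b)
    (hF : ContinuousOn F (Icc 0 b)) : ∃ v, HasVectorIntegral F (Ioc 0 b) v :=
  (hE _ (cauchySeq_riemannSum hb hF)).imp fun _ =>
    hasVectorIntegral_of_tendsto_riemannSum hb hF

theorem exists_clm_hasVectorIntegral [T2Space E] [PolynormableSpace ℂ E] [BarrelledSpace ℂ E]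
    (hE : ∀ u : ℕ → E, CauchySeq u → ∃ x : E, Tendsto u atTop (𝓝 x)) (hb : 0 ≤ b)
    {T : ℝ → E →L[ℂ] E} (hT : ∀ x, ContinuousOn (fun t => T t x) (Icc 0 b)) :
    ∃ L : E →L[ℂ] E, ∀ x, HasVectorIntegral (fun t => T t x) (Ioc 0 b) (L x) := by
  choose L hL using fun x => exists_hasVectorIntegral hE hb (hT x)
  let Llin : E →ₗ[ℂ] E :=
    { toFun := L
      map_add' := fun x y => (hL (x + y)).unique <| by
        simpa only [map_add] using (hL x).add (hL y)
      map_smul' := fun c x => (hL (c • x)).unique <| by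
        simpa only [map_smul, RingHom.id_apply] using (hL x).smul c }
  refine ⟨⟨Llin, ?_⟩, hL⟩
  refine (PolynormableSpace.withSeminorms ℂ E).continuous_of_continuous_comp Llin fun ⟨p, hp⟩ => ?_
  obtain ⟨q, hq, hpq⟩ := exists_seminorm_comp_le_of_isCompact isCompact_Icc hT hp
  refine Seminorm.continuous_of_le (q := b.toNNReal • q) (hq.const_smul b.toNNReal) fun x => ?_
  calc p (L x) ≤ q x * volume.real (Ioc 0 b) :=
        (hL x).seminorm_le measure_Ioc_lt_top hp fun t ht => hpq t (Ioc_subset_Icc_self ht) x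
    _ = b.toNNReal • q x := by
        rw [Real.volume_real_Ioc_of_le hb, sub_zero, mul_comm, NNReal.smul_def,
          Real.coe_toNNReal b hb, smul_eq_mul]

variable [ContinuousSMul ℂ E]

theorem exists_clm_hasVectorIntegral_Ioi [T2Space E] [PolynormableSpace ℂ E] [BarrelledSpace ℂ E]
    (hE : ∀ u : ℕ → E, CauchySeq u → ∃ x : E, Tendsto u atTop (𝓝 x))
    {S : ℝ → E →L[ℂ] E} (hS : ∀ x, ContinuousOn (fun t => S t x) (Ici 0))
    {w : ℝ → ℂ} (hw : Continuous w) (hw₀ : w =ᶠ[atTop] 0) :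
    ∃ L : E →L[ℂ] E, ∀ x, HasVectorIntegral (fun t => w t • S t x) (Ioi 0) (L x) := by
  obtain ⟨R, hR⟩ := eventually_atTop.1 hw₀
  obtain ⟨L, hL⟩ := exists_clm_hasVectorIntegral hE (le_max_right R 0) (T := fun t => w t • S t)
    fun x => hw.continuousOn.smul ((hS x).mono Icc_subset_Ici_self)
  refine ⟨L, fun x => ?_⟩
  refine (hasVectorIntegral_iff_of_subset measurableSet_Ioi Ioc_subset_Ioi_self ?_).1 (hL x)
  rintro t ⟨ht, htR⟩
  have hwt : w t = 0 := hR t <| not_lt.1 fun h => htR ⟨ht, h.le.trans (le_max_left _ _)⟩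
  exact (congrArg (· • S t x) hwt).trans (zero_smul ℂ _)

theorem exists_linearMap_hasVectorIntegral_Ioi [T2Space E] [PolynormableSpace ℂ E]
    [BarrelledSpace ℂ E] (hE : ∀ u : ℕ → E, CauchySeq u → ∃ x : E, Tendsto u atTop (𝓝 x))
    {S : ℝ → E →L[ℂ] E} (hS : ∀ x, ContinuousOn (fun t => S t x) (Ici 0))
    {V : Type*} [AddCommGroup V] [Module ℂ V] {W : V →ₗ[ℂ] (ℝ → ℂ)}
    (hW : ∀ φ, Continuous (W φ)) (hW₀ : ∀ φ, W φ =ᶠ[atTop] 0) :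
    ∃ G : V →ₗ[ℂ] (E →L[ℂ] E),
      ∀ φ x, HasVectorIntegral (fun t => W φ t • S t x) (Ioi 0) (G φ x) := by
  choose G hG using fun φ => exists_clm_hasVectorIntegral_Ioi hE hS (hW φ) (hW₀ φ)
  refine ⟨⟨⟨G, fun φ ψ => ?_⟩, fun c φ => ?_⟩, hG⟩ <;> ext x
  · refine (hG (φ + ψ) x).unique ?_
    simpa only [map_add, Pi.add_apply, add_smul] using! (hG φ x).add (hG ψ x)
  · refine (hG (c • φ) x).unique ?_
    simpa only [map_smul, Pi.smul_apply, smul_assoc] using! (hG φ x).smul c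

end Existence

section Distribution

variable {E : Type*} [AddCommGroup E] [Module ℂ E] [Module ℝ E] [IsScalarTower ℝ ℂ E]

theorem continuous_of_seminorm_le [TopologicalSpace E] [IsTopologicalAddGroup E]
    [ContinuousSMul ℂ E] [LocallyConvexSpace ℝ E] {G : TestFn →ₗ[ℂ] (E →L[ℂ] E)}
    (hG : ∀ (K : Compacts ℝ) (hK : (K : Set ℝ) ⊆ (⊤ : Opens ℝ)) (p : Seminorm ℂ E), Continuous p →
      ∃ (n : ℕ) (q : Seminorm ℂ E), Continuous q ∧ ∀ (φ : 𝓓^{⊤}_{K}(ℝ, ℂ)) (x : E),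
        p (G (TestFunction.ofSupportedIn hK φ) x) ≤
          ContDiffMapSupportedIn.seminorm ℂ ℝ ℂ ⊤ K n φ * q x) :
    Continuous G := by
  have := polynormableSpace_of_real E
  have : ContinuousSMul ℝ E := IsScalarTower.continuousSMul ℂ
  have : ContinuousSMul ℝ (E →L[ℂ] E) := IsScalarTower.continuousSMul ℂ
  refine (TestFunction.continuous_iff_continuous_comp G).2 fun K hK => ?_
  let GK : 𝓓^{⊤}_{K}(ℝ, ℂ) →ₗ[ℂ] (E →L[ℂ] E) :=
    G ∘ₗ (TestFunction.ofSupportedInCLM ℂ hK : 𝓓^{⊤}_{K}(ℝ, ℂ) →L[ℂ] TestFn).toLinearMap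
  refine continuous_of_continuousAt_zero GK ?_
  rw [ContinuousAt, map_zero, ContinuousLinearMap.hasBasis_nhds_zero.tendsto_right_iff]
  rintro ⟨B, V⟩ ⟨hB, hV⟩
  obtain ⟨p, hp, r, hr, hpV⟩ := exists_seminorm_ball_subset hV
  obtain ⟨n, q, hq, hpq⟩ := hG K hK p hp
  obtain ⟨M, hM⟩ := (PolynormableSpace.withSeminorms ℂ E).isVonNBounded_iff_seminorm_bddAbove.1 hB
    ⟨q, hq⟩
  have hsmall : Tendsto (fun φ => ContDiffMapSupportedIn.seminorm ℂ ℝ ℂ ⊤ K n φ * M) (𝓝 0)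
      (𝓝 0) :=
    (((ContDiffMapSupportedIn.withSeminorms ℂ ℝ ℂ ⊤ K).continuous_seminorm n).mul
      continuous_const).tendsto' 0 0 (by rw [Pi.mul_apply, map_zero, zero_mul])
  filter_upwards [hsmall.eventually_lt_const hr] with φ hφ x hx
  refine hpV ((p.mem_ball_zero).2 ?_)
  calc p (GK φ x) ≤ ContDiffMapSupportedIn.seminorm ℂ ℝ ℂ ⊤ K n φ * q x := hpq φ x
    _ ≤ ContDiffMapSupportedIn.seminorm ℂ ℝ ℂ ⊤ K n φ * M := by
        gcongr
        exact hM (mem_image_of_mem q hx)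
    _ < r := hφ

theorem exists_distribution_hasVectorIntegral [UniformSpace E] [IsUniformAddGroup E]
    [ContinuousSMul ℂ E] [LocallyConvexSpace ℝ E] [T2Space E] [BarrelledSpace ℂ E]
    (hE : ∀ u : ℕ → E, CauchySeq u → ∃ x : E, Tendsto u atTop (𝓝 x))
    {S : ℝ → E →L[ℂ] E} (hS : ∀ x, ContinuousOn (fun t => S t x) (Ici 0))
    {W : TestFn →ₗ[ℂ] (ℝ → ℂ)} (hW : ∀ φ, Continuous (W φ))
    (hbound : ∀ (K : Compacts ℝ) (hK : (K : Set ℝ) ⊆ (⊤ : Opens ℝ)),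
      ∃ R ≥ (0 : ℝ), ∃ (c : ℝ) (n : ℕ), ∀ φ : 𝓓^{⊤}_{K}(ℝ, ℂ),
        (∀ t ≥ R, W (TestFunction.ofSupportedIn hK φ) t = 0) ∧
        ∀ t ≥ 0, ‖W (TestFunction.ofSupportedIn hK φ) t‖ ≤
          c * ContDiffMapSupportedIn.seminorm ℂ ℝ ℂ ⊤ K n φ) :
    ∃ G : TestFn →L[ℂ] (E →L[ℂ] E),
      ∀ φ x, HasVectorIntegral (fun t => W φ t • S t x) (Ioi 0) (G φ x) := by
  have := polynormableSpace_of_real E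
  have hW₀ (φ : TestFn) : W φ =ᶠ[atTop] 0 := by
    obtain ⟨R, -, c, n, h⟩ := hbound ⟨tsupport φ, φ.hasCompactSupport⟩ fun _ _ => trivial
    have hφ := (h ⟨φ, φ.contDiff, fun t ht => image_eq_zero_of_notMem_tsupport ht⟩).1
    exact eventually_atTop.2 ⟨R, hφ⟩
  obtain ⟨G, hG⟩ := exists_linearMap_hasVectorIntegral_Ioi hE hS hW hW₀
  refine ⟨⟨G, continuous_of_seminorm_le fun K hK p hp => ?_⟩, hG⟩
  obtain ⟨R, hR, c, n, hc⟩ := hbound K hK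
  obtain ⟨q, hq, hpq⟩ := exists_seminorm_comp_le_of_isCompact isCompact_Icc
    (fun x => (hS x).mono (Icc_subset_Ici_self (a := R))) hp
  refine ⟨n, (c * R).toNNReal • q, hq.const_smul (c * R).toNNReal, fun φ x => ?_⟩
  set N := ContDiffMapSupportedIn.seminorm ℂ ℝ ℂ ⊤ K n φ
  obtain ⟨hφ₀, hφ⟩ := hc φ
  have hint : HasVectorIntegral (fun t => W (TestFunction.ofSupportedIn hK φ) t • S t x)
      (Ioc 0 R) (G (TestFunction.ofSupportedIn hK φ) x) := by
    refine (hasVectorIntegral_iff_of_subset measurableSet_Ioi Ioc_subset_Ioi_self ?_).2 (hG _ x)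
    rintro t ⟨ht, htR⟩
    rw [hφ₀ t (not_lt.1 fun h => htR ⟨ht, h.le⟩), zero_smul]
  have hle (t : ℝ) (ht : t ∈ Ioc 0 R) :
      p (W (TestFunction.ofSupportedIn hK φ) t • S t x) ≤ c * N * q x := by
    rw [map_smul_eq_mul]
    exact mul_le_mul (hφ t ht.1.le) (hpq t (Ioc_subset_Icc_self ht) x) (apply_nonneg p _)
      ((norm_nonneg _).trans (hφ t ht.1.le))
  calc p (G (TestFunction.ofSupportedIn hK φ) x) ≤ c * N * q x * volume.real (Ioc 0 R) :=
        hint.seminorm_le measure_Ioc_lt_top hp hle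
    _ = c * R * (N * q x) := by
        rw [Real.volume_real_Ioc_of_le hR]
        ring
    _ ≤ (c * R).toNNReal * (N * q x) := by
        gcongr
        exact Real.le_coe_toNNReal _
    _ = N * ((c * R).toNNReal * q x) := by ring

theorem exists_norm_weylDeriv_le (α : ℝ) (K : Compacts ℝ) (hK : (K : Set ℝ) ⊆ (⊤ : Opens ℝ)) :
    ∃ R ≥ (0 : ℝ), ∃ (c : ℝ), ∀ φ : 𝓓^{⊤}_{K}(ℝ, ℂ),
      (∀ t ≥ R, weylDeriv α (TestFunction.ofSupportedIn hK φ) t = 0) ∧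
      ∀ t ≥ 0, ‖weylDeriv α (TestFunction.ofSupportedIn hK φ) t‖ ≤
        c * ContDiffMapSupportedIn.seminorm ℂ ℝ ℂ ⊤ K ⌈α⌉₊ φ := by
  obtain ⟨R, hR⟩ := K.isCompact.bddAbove
  obtain ⟨c, hle⟩ := exists_norm_fracInt_le (ceil_sub_nonneg α) (max R 0 + 1)
  refine ⟨max R 0 + 1, by positivity, c, fun φ => ?_⟩
  have hsupp : tsupport (TestFunction.ofSupportedIn hK φ) ⊆ Iio (max R 0 + 1) := fun t ht =>
    (hR (φ.tsupport_subset ht)).trans_lt (by grind)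
  refine ⟨fun t => weylDeriv_eq_zero α hsupp, fun t ht => ?_⟩
  rw [weylDeriv_eq_fracInt, norm_mul, norm_pow, norm_neg, norm_one, one_pow, one_mul]
  refine hle _ _ (fun s => ?_) (fun s => iterate_testDeriv_eq_zero hsupp ⌈α⌉₊) t ht
  rw [← iteratedDeriv_eq_iterate_testDeriv, ← norm_iteratedFDeriv_eq_norm_iteratedDeriv]
  exact ContDiffMapSupportedIn.norm_iteratedFDeriv_apply_le_seminorm_top ℂ (f := φ)

end Distribution

section IntegrationByParts

theorem integrableOn_Ioi_mul {u F : ℝ → ℂ} (hu : Continuous u) (hu₀ : u =ᶠ[atTop] 0)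
    (hF : Continuous F) : IntegrableOn (fun t => u t * F t) (Ioi 0) := by
  obtain ⟨R, hR⟩ := eventually_atTop.1 hu₀
  refine ((hu.mul hF).integrableOn_Ioc (a := 0) (b := R)).of_forall_sdiff_eq_zero
    measurableSet_Ioi fun t ⟨ht, htR⟩ => ?_
  simp [hR t (not_lt.1 fun h => htR ⟨ht, h.le⟩)]

theorem integral_Ioi_deriv_mul_primitive {u u' F : ℝ → ℂ} (hu : ∀ t, HasDerivAt u (u' t) t)
    (hu₀ : u =ᶠ[atTop] 0) (hu' : Continuous u') (hu'₀ : u' =ᶠ[atTop] 0) (hF : Continuous F) :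
    ∫ t in Ioi 0, u' t * ∫ s in (0 : ℝ)..t, F s = -∫ t in Ioi 0, u t * F t := by
  have hucont : Continuous u := continuous_iff_continuousAt.2 fun t => (hu t).continuousAt
  have hP (t : ℝ) : HasDerivAt (fun t => ∫ s in (0 : ℝ)..t, F s) (F t) t :=
    (hF.integral_hasStrictDerivAt 0 t).hasDerivAt
  have hPcont : Continuous fun t => ∫ s in (0 : ℝ)..t, F s :=
    continuous_iff_continuousAt.2 fun t => (hP t).continuousAt
  have hzero : Tendsto (fun t => u t * ∫ s in (0 : ℝ)..t, F s) (𝓝[>] 0) (𝓝 0) :=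
    ((hucont.mul hPcont).tendsto' 0 0 (by simp)).mono_left nhdsWithin_le_nhds
  have htop : Tendsto (fun t => u t * ∫ s in (0 : ℝ)..t, F s) atTop (𝓝 0) :=
    tendsto_const_nhds.congr' (hu₀.mono fun t ht => by simp [ht])
  have hparts := integral_Ioi_mul_deriv_eq_deriv_mul (fun t _ => hu t) (fun t _ => hP t)
    (integrableOn_Ioi_mul hucont hu₀ hF) (integrableOn_Ioi_mul hu' hu'₀ hPcont) hzero htop
  rw [hparts]
  ring

theorem continuous_gFun_add_one {α : ℝ} (hα : 0 ≤ α) : Continuous (gFun (α + 1)) := by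
  unfold gFun
  rw [add_sub_cancel_right]
  exact (Real.continuous_rpow_const hα).div_const _

theorem TestFn.apply_zero_of_tsupport_subset_Ici {φ : TestFn} (hφ : tsupport φ ⊆ Ici 0) :
    φ 0 = 0 := by
  have hneg : EqOn φ 0 (Iio 0) := fun t ht =>
    image_eq_zero_of_notMem_tsupport fun h => not_lt.2 (mem_Ici.1 (hφ h)) ht
  exact hneg.closure φ.continuous continuous_zero (closure_Iio (0 : ℝ) ▸ self_mem_Iic)

theorem integral_weylDeriv_testDeriv_mul_gFun {α : ℝ} (hα : 0 ≤ α) (φ : TestFn) :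
    ∫ t in Ioi 0, weylDeriv α (testDeriv φ) t * (gFun (α + 1) t : ℂ) = -φ 0 := by
  have hw := continuous_weylDeriv α (testDeriv φ)
  have hα₁ : 0 ≤ 1 + α := by positivity
  calc ∫ t in Ioi 0, weylDeriv α (testDeriv φ) t * (gFun (α + 1) t : ℂ)
      = fracInt (1 + α) (weylDeriv α (testDeriv φ)) 0 := by
        rw [fracInt_of_pos (by positivity), ← integral_indicator measurableSet_Ioi]
        congr with t
        by_cases ht : 0 < t <;> simp [fracKer, ht, mul_comm, add_comm]
    _ = fracInt 1 (fracInt α (weylDeriv α (testDeriv φ))) 0 :=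
        (fracInt_fracInt zero_le_one hα hw.aestronglyMeasurable
          (fracIntegrable_of_continuous hα₁ hw (weylDeriv_eventuallyEq_zero α _))).symm
    _ = -φ 0 := by
        rw [fracInt_weylDeriv hα, fracInt_one_testDeriv]
        exact neg_one_mul _

end IntegrationByParts

section DistributionSemigroup

variable {E : Type*} [AddCommGroup E] [Module ℂ E] [TopologicalSpace E] {α : ℝ} {C : E →L[ℂ] E}
  {S : ℝ → E →L[ℂ] E}

theorem IsIntegratedCSemigroup.integral_weylDeriv_conv0 (hα : 0 ≤ α)
    (hS : IsIntegratedCSemigroup α C S) (φ ψ : TestFn) (x : E) (f : E →L[ℂ] ℂ) :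
    ∫ r in Ioi 0, weylDeriv α (conv0 φ ψ) r * f (S r (C x)) =
      ∫ t in Ioi 0, weylDeriv α φ t * ∫ s in Ioi 0, weylDeriv α ψ s * f (S t (S s x)) := by
  have hF : ContinuousOn (fun r => f (S r (C x))) (Ici 0) :=
    f.continuous.comp_continuousOn (hS.continuousOn (C x))
  rcases hα.eq_or_lt with rfl | hα
  · have hweyl (χ : TestFn) : weylDeriv 0 χ = χ := by
      rw [← fracInt_zero (weylDeriv 0 χ), fracInt_weylDeriv le_rfl]
    simp only [hweyl]
    refine (integral_conv0 φ ψ hF).trans ?_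
    refine setIntegral_congr_fun measurableSet_Ioi fun t (ht : 0 < t) =>
      congrArg (φ t * ·) (setIntegral_congr_fun measurableSet_Ioi fun s (hs : 0 < s) => ?_)
    simp only [hS.mul_zero rfl t s ht.le hs.le]
  · choose! I₁ I₂ I₃ h₁ h₂ h₃ hI using fun t (ht : 0 ≤ t) s (hs : 0 ≤ s) =>
      hS.mul_pos hα t s ht hs x
    refine DegenerateCSemigroup.integral_weylDeriv_conv0 hα φ ψ hF (fun t ht s hs => ?_)
      fun t ht s hs => ?_
    · simpa only [map_smul, smul_eq_mul] using (h₁ t ht.le s hs.le f).1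
    · rw [hI t ht.le s hs.le, map_sub, map_sub, ← (h₁ t ht.le s hs.le f).2,
        ← (h₂ t ht.le s hs.le f).2, ← (h₃ t ht.le s hs.le f).2]
      simp only [map_smul, smul_eq_mul]

theorem integral_weylDeriv_testDeriv_of_mem_integralGenerator (hα : 0 ≤ α)
    (hS : ∀ x, ContinuousOn (fun t => S t x) (Ici 0)) {x y : E}
    (hxy : (x, y) ∈ integralGenerator α C S) (φ : TestFn) (f : E →L[ℂ] ℂ) :
    ∫ t in Ioi 0, weylDeriv α (testDeriv φ) t * f (S t x) =
      -φ 0 * f (C x) - ∫ t in Ioi 0, weylDeriv α φ t * f (S t y) := by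
  let F (t : ℝ) : ℂ := f (S (max t 0) y)
  have hF : Continuous F := f.continuous.comp <|
    (hS y).comp_continuous (by fun_prop) fun t => le_max_right t 0
  have hFS (t : ℝ) (ht : 0 < t) : F t = f (S t y) := by
    simp only [F, max_eq_left ht.le]
  have hfS (t : ℝ) (ht : t ∈ Ioi 0) : f (S t x) =
      (gFun (α + 1) t : ℂ) * f (C x) + ∫ s in (0 : ℝ)..t, F s := by
    have hgen := (hxy t (le_of_lt ht) f).2
    rw [map_sub, map_smul, smul_eq_mul] at hgen
    rw [intervalIntegral.integral_of_le (le_of_lt ht),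
      setIntegral_congr_fun measurableSet_Ioc fun s hs => hFS s hs.1, hgen, add_sub_cancel]
  have hw := continuous_weylDeriv α (testDeriv φ)
  have hw₀ := weylDeriv_eventuallyEq_zero α (testDeriv φ)
  have hg : Continuous fun t => (gFun (α + 1) t : ℂ) :=
    Complex.continuous_ofReal.comp (continuous_gFun_add_one hα)
  have hP : Continuous fun t => ∫ s in (0 : ℝ)..t, F s :=
    intervalIntegral.continuous_primitive hF.intervalIntegrable 0
  calc ∫ t in Ioi 0, weylDeriv α (testDeriv φ) t * f (S t x)
      = ∫ t in Ioi 0, (weylDeriv α (testDeriv φ) t * (gFun (α + 1) t : ℂ) * f (C x) +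
          weylDeriv α (testDeriv φ) t * ∫ s in (0 : ℝ)..t, F s) :=
        setIntegral_congr_fun measurableSet_Ioi fun t ht => by
          simp only [hfS t ht]
          ring
    _ = -φ 0 * f (C x) - ∫ t in Ioi 0, weylDeriv α φ t * F t := by
        rw [integral_add ((integrableOn_Ioi_mul hw hw₀ hg).mul_const _)
          (integrableOn_Ioi_mul hw hw₀ hP), integral_mul_const,
          integral_weylDeriv_testDeriv_mul_gFun hα, sub_eq_add_neg,
          integral_Ioi_deriv_mul_primitive (hasDerivAt_weylDeriv α φ)
            (weylDeriv_eventuallyEq_zero α φ) hw hw₀ hF]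
    _ = -φ 0 * f (C x) - ∫ t in Ioi 0, weylDeriv α φ t * f (S t y) := by
        rw [setIntegral_congr_fun measurableSet_Ioi fun t ht =>
          congrArg (weylDeriv α φ t * ·) (hFS t ht)]

variable [IsTopologicalAddGroup E] [ContinuousSMul ℂ E] [PolynormableSpace ℂ E] [T2Space E]
  {G : TestFn →L[ℂ] (E →L[ℂ] E)}

theorem IsIntegratedCSemigroup.isPreCDS (hα : 0 ≤ α) (hS : IsIntegratedCSemigroup α C S)
    (hG : ∀ (φ : TestFn) (x : E),
      HasVectorIntegral (fun t => weylDeriv α φ t • S t x) (Ioi 0) (G φ x)) :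
    IsPreCDS C G where
  support φ hφ := by
    ext x
    refine (hG φ x).unique ((hasVectorIntegral_zero _).congr measurableSet_Ioi fun t ht => ?_)
    rw [weylDeriv_eq_zero α hφ (le_of_lt ht), zero_smul]
  comm φ := by
    ext x
    refine ((hG φ x).map C).unique ((hG φ (C x)).congr measurableSet_Ioi fun t ht => ?_)
    rw [hS.comm t (le_of_lt ht), map_smul]
  mul φ ψ := by
    ext x
    refine (hG (conv0 φ ψ) (C x)).unique fun f => ⟨(hG (conv0 φ ψ) (C x) f).1, ?_⟩
    have hφ := (hG φ (G ψ x) f).2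
    have hψ (t : ℝ) := ((hG ψ x).map (S t) f).2
    simp only [map_smul, smul_eq_mul] at hφ hψ ⊢
    rw [hS.integral_weylDeriv_conv0 hα]
    simp only [hψ]
    exact hφ

theorem IsIntegratedCSemigroup.integralGenerator_le_distGenerator (hα : 0 ≤ α)
    (hS : IsIntegratedCSemigroup α C S)
    (hG : ∀ (φ : TestFn) (x : E),
      HasVectorIntegral (fun t => weylDeriv α φ t • S t x) (Ioi 0) (G φ x)) :
    integralGenerator α C S ≤ distGenerator G := by
  rintro ⟨x, y⟩ hxy φ hφ
  rw [map_neg, neg_apply]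
  refine HasVectorIntegral.unique (fun f => ⟨(hG φ y f).1, ?_⟩) (hG φ y)
  have hparts := integral_weylDeriv_testDeriv_of_mem_integralGenerator hα hS.continuousOn hxy φ f
  rw [TestFn.apply_zero_of_tsupport_subset_Ici hφ, neg_zero, zero_mul, zero_sub] at hparts
  simp only [map_neg, ← (hG (testDeriv φ) x f).2, map_smul, smul_eq_mul, hparts, neg_neg]

end DistributionSemigroup

end DegenerateCSemigroup

end

open DegenerateCSemigroup in
theorem theorem4p6 {E : Type*} [AddCommGroup E] [Module ℂ E] [Module ℝ E] [IsScalarTower ℝ ℂ E]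
    [UniformSpace E] [IsUniformAddGroup E] [ContinuousSMul ℂ E] [LocallyConvexSpace ℝ E]
    [T2Space E] [BarrelledSpace ℂ E]
    (hE : ∀ u : ℕ → E, CauchySeq u → ∃ x : E, Tendsto u atTop (𝓝 x))
    (α : ℝ) (hα : 0 ≤ α) (C : E →L[ℂ] E) (S : ℝ → E →L[ℂ] E)
    (hS : IsIntegratedCSemigroup α C S)
    (A : Submodule ℂ (E × E)) (hA : A = integralGenerator α C S) :
    ∃ G : TestFn →L[ℂ] (E →L[ℂ] E),
      (∀ (φ : TestFn) (x : E),
        HasVectorIntegral (fun t => weylDeriv α φ t • S t x) (Ioi 0) (G φ x)) ∧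
      IsPreCDS C G ∧
      A ≤ distGenerator G := by
  have := polynormableSpace_of_real E
  obtain ⟨G, hG⟩ := exists_distribution_hasVectorIntegral hE hS.continuousOn
    (W := weylDerivLM α) (continuous_weylDeriv α) fun K hK => by
      obtain ⟨R, hR, c, h⟩ := exists_norm_weylDeriv_le α K hK
      exact ⟨R, hR, c, ⌈α⌉₊, h⟩
  exact ⟨G, hG, hS.isPreCDS hα hG, hA ▸ hS.integralGenerator_le_distGenerator hα hG⟩
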